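/- **Setting.** Fix $N\ge 2$ parallel servers with arbitrary (equal or unequal) rates $\mu_1,\dots,\mu_N>0$; put $\mu_\Sigma=\sum_n\mu_n$ and $\mu_{\min}=\min_n\mu_n$. Time is slotted. In slot $t$, $A_\Sigma(t)$ jobs arrive, i.i.d. in $t$ and bounded by a constant $A_{\max}$; all of them are routed to one server, so that $A_s(t)=A_\Sigma(t)$ for the chosen server $s$ and $A_n(t)=0$ for $n\ne s$. Server $n$ offers service $S_n(t)$, i.i.d. in $t$, independent across servers and of the arrivals, bounded by a constant $S_{\max}$, with mean $\mu_n$ (arrivals and services are nonnegative integers). Queue lengths evolve by $Q_n(t+1)=[Q_n(t)+A_n(t)-S_n(t)]^+$. The state is $Z(t)=(\mathbf Q(t),m(t))$, where $m(t)\subseteq\{1,\dots,N\}$ is the dispatcher's memory; a policy chooses server $n$ with probability $p_n(t)$, a function of $Z(t)$ (and possibly of $t$), and updates $m$. Join-shortest-queue (JSQ) routes the arrivals to a server with the shortest queue, ties broken uniformly at random, and keeps no memory. **Tilted distributions and the class $\Pi$.** Let $\sigma$ be an ordering of the servers with $Q_{\sigma(1)}\le\dots\le Q_{\sigma(N)}$;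 put $P_n=p_{\sigma(n)}$ and $\Delta_n=P_n-\mu_{\sigma(n)}/\mu_\Sigma$. A probability vector $P$ is *tilted* if for some $k\in\{2,\dots,N\}$, $\Delta_n\ge0$ for $n<k$ and $\Delta_n\le0$ for $n\ge k$; for $\delta>0$ it is *$\delta$-tilted* if moreover $\Delta_1\ge\delta$ and $\Delta_N\le-\delta$. Probability vectors $P,\hat P$ are *equivalent in inner product* if $\sum_nQ_{\sigma(n)}P_n=\sum_nQ_{\sigma(n)}\hat P_n$. A policy belongs to $\Pi$ if (i) for all $t$, all states and all such $\sigma$, $P(t)$ or a vector equivalent to it is tilted; and (ii) there are constants $T\in\{1,2,\dots\}$ and $\delta>0$, independent of the arrivals, such that each block $\{kT,\dots,(k+1)T-1\}$, $k\ge0$, contains a slot $t_k$ at which, for all states and all such $\sigma$, $P(t_k)$ or a vector equivalent to it is $\delta$-tilted. **Optimality.** A policy is *throughput optimal* if, for all services as above, all arrivals as above with mean below $\mu_\Sigma$, and every initial distribution, $\limsup_{C\to\infty}\limsup_{t\to\infty}\mathbb P(\sum_nQ_n(t)>C)=0$. Consider arrivals $A^{(\epsilon)}_\Sigma$, $0<\epsilon<\epsilon_0$,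 with mean $\mu_\Sigma-\epsilon$, a bound $A_{\max}$ independent of $\epsilon$, and variances converging as $\epsilon\downarrow0$, and services not depending on $\epsilon$. The *resource-pooled system* is the single queue $q(t+1)=[q(t)+A^{(\epsilon)}_\Sigma(t)-\sum_nS_n(t)]^+$. A policy is *heavy-traffic delay optimal* if, for all such arrivals and services, stationary distributions of $Z^{(\epsilon)}$ and $q^{(\epsilon)}$ exist for every $\epsilon\in(0,\epsilon_0)$, and for any choice of stationary $\overline{\mathbf Q}^{(\epsilon)}$ and $\overline q^{(\epsilon)}$ both limits below exist, are finite, and satisfy $$\lim_{\epsilon\downarrow0}\epsilon\,\mathbb E\Big[\sum_n\overline Q^{(\epsilon)}_n\Big]=\lim_{\epsilon\downarrow0}\epsilon\,\mathbb E\big[\overline q^{(\epsilon)}\big].$$ **Proposition.** JSQ belongs to $\Pi$. More precisely, with $\delta=\mu_{\min}/\mu_\Sigma$, at every time, in every state and for every such ordering $\sigma$, the dispatching distribution $P$ of JSQ or a probability vector equivalent to it in inner product is $\delta$-tilted, and $P$ itself is $\delta$-tilted if no two queue lengths are equal. JSQ is throughput optimal and heavy-traffic delay optimal. -/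

import Mathlib

open MeasureTheory ProbabilityTheory Filter Topology
open scoped ENNReal NNReal

noncomputable section

namespace LoadBalancing

/-! ### The time-slotted load balancing system -/

/-- The system state `Z = (Q, m)`: the queue lengths of the `N` servers, and the set of server IDs
stored in the memory of the dispatcher. -/
abbrev State (N : ℕ) : Type := (Fin N → ℕ) × Finset (Fin N)

/-- A load balancing policy. In time slot `t` and state `z`, all new arrivals are sent to one server,
chosen with law `dispatch t z`; afterwards the memory is refreshed with law `updateMemory t z a s Q'`,
where `a` is the number of arrivals, `s` the chosen server and `Q'` the new queue length vector. -/
structure Policy (N : ℕ) where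
  dispatch : ℕ → State N → PMF (Fin N)
  updateMemory : ℕ → State N → ℕ → Fin N → (Fin N → ℕ) → PMF (Finset (Fin N))

/-- The mean of a law on the nonnegative integers. -/
def mean (p : PMF ℕ) : ℝ := ∫ k : ℕ, (k : ℝ) ∂p.toMeasure

/-- The variance of a law on the nonnegative integers. -/
def var (p : PMF ℕ) : ℝ := variance (fun k : ℕ => (k : ℝ)) p.toMeasure

/-- The law is carried by `{0, …, b}`. -/
def BoundedBy (b : ℕ) (p : PMF ℕ) : Prop := ∀ k ∈ p.support, k ≤ b

/-- `svc n` is the law of the potential service `S_n(t)`: bounded, with mean `μ n`. -/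
def IsServiceLaw {N : ℕ} (μ : Fin N → ℝ) (svc : Fin N → PMF ℕ) : Prop :=
  (∃ Smax : ℕ, ∀ n, BoundedBy Smax (svc n)) ∧ ∀ n, mean (svc n) = μ n

/-- The joint law of `(S_1(t), …, S_N(t))`: services are independent across queues. -/
def serviceLaw {N : ℕ} (svc : Fin N → PMF ℕ) : PMF (Fin N → ℕ) :=
  (Measure.pi fun n => (svc n).toMeasure).toPMF

/-- `Q_n(t+1) = [Q_n(t) + A_n(t) - S_n(t)]⁺`, when the `a` arrivals are all routed to queue `s`
(subtraction of natural numbers is truncated at zero). -/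
def nextQueue {N : ℕ} (Q : Fin N → ℕ) (a : ℕ) (s : Fin N) (S : Fin N → ℕ) : Fin N → ℕ :=
  fun n => Q n + (if n = s then a else 0) - S n

/-- The law of `Z(t+1)` given `Z(t) = z`. The arrivals (with law `arr`), the services and the
dispatching decision of a slot are drawn independently of each other given `z`, and of the past. -/
def transition {N : ℕ} (p : Policy N) (arr : PMF ℕ) (svc : Fin N → PMF ℕ) (t : ℕ) (z : State N) :
    PMF (State N) :=
  arr.bind fun a => (serviceLaw svc).bind fun S => (p.dispatch t z).bind fun s =>
    (p.updateMemory t z a s (nextQueue z.1 a s S)).map fun m => (nextQueue z.1 a s S, m)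

/-- The law of `Z(t)` for the Markov chain with initial law `init`. -/
def law {N : ℕ} (p : Policy N) (arr : PMF ℕ) (svc : Fin N → PMF ℕ) (init : PMF (State N)) :
    ℕ → PMF (State N)
  | 0 => init
  | t + 1 => (law p arr svc init t).bind (transition p arr svc t)

/-- `π` is a stationary distribution of `{Z(t)}`. -/
def IsStationary {N : ℕ} (p : Policy N) (arr : PMF ℕ) (svc : Fin N → PMF ℕ) (π : PMF (State N)) :
    Prop :=
  ∀ t, π.bind (transition p arr svc t) = π

/-- The expected total queue length `E[∑ₙ Qₙ]` when the state has law `π`. -/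
def expectedTotal {N : ℕ} (π : PMF (State N)) : ℝ≥0∞ := ∑' z, π z * ((∑ n, z.1 n : ℕ) : ℝ≥0∞)

/-! ### The resource-pooled system -/

/-- One step of the resource-pooled single-server queue, with the same arrivals `a(t) = A_Σ(t)` and
with service `s(t) = ∑ₙ Sₙ(t)`. -/
def pooledTransition {N : ℕ} (arr : PMF ℕ) (svc : Fin N → PMF ℕ) (q : ℕ) : PMF ℕ :=
  arr.bind fun a => (serviceLaw svc).map fun S => q + a - ∑ n, S n

/-- `ρ` is a stationary distribution of the resource-pooled queue. -/
def IsPooledStationary {N : ℕ} (arr : PMF ℕ) (svc : Fin N → PMF ℕ) (ρ : PMF ℕ) : Prop :=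
  ρ.bind (pooledTransition arr svc) = ρ

/-- The expected queue length when it has law `ρ`. -/
def expectedLength (ρ : PMF ℕ) : ℝ≥0∞ := ∑' q, ρ q * (q : ℝ≥0∞)

/-! ### Optimality -/

/-- Stability of `{Z(t)}` started from `init`:
`limsup_{C → ∞} limsup_{t → ∞} P(∑ₙ Qₙ(t) > C) = 0`. -/
def IsStable {N : ℕ} (p : Policy N) (arr : PMF ℕ) (svc : Fin N → PMF ℕ) (init : PMF (State N)) :
    Prop :=
  limsup (fun C : ℝ => limsup (fun t : ℕ =>
    (law p arr svc init t).toOuterMeasure {z | C < ((∑ n, z.1 n : ℕ) : ℝ)}) atTop) atTop = 0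

/-- Throughput optimality at service rates `μ`: the system is stable for every admissible arrival
law with rate below `μ_Σ`, every admissible service law, and every initial law. -/
def ThroughputOptimal {N : ℕ} (μ : Fin N → ℝ) (p : Policy N) : Prop :=
  ∀ (svc : Fin N → PMF ℕ), IsServiceLaw μ svc →
  ∀ (arr : PMF ℕ) (Amax : ℕ), BoundedBy Amax arr → mean arr < ∑ n, μ n →
  ∀ init : PMF (State N), IsStable p arr svc init

/-- Heavy-traffic delay optimality at service rates `μ`. For all admissible service laws and all
families of arrival laws `arr ε` bounded by a common constant, with mean `μ_Σ - ε` and with variances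
that converge as `ε ↓ 0`: stationary distributions exist, for the system and for the resource-pooled
queue, and for any choice of them, `ε E[∑ₙ Qₙ]` and `ε E[q]` converge to one and the same finite limit
as `ε ↓ 0`. -/
def HeavyTrafficDelayOptimal {N : ℕ} (μ : Fin N → ℝ) (p : Policy N) : Prop :=
  ∀ (svc : Fin N → PMF ℕ), IsServiceLaw μ svc →
  ∀ (ε₀ : ℝ) (arr : ℝ → PMF ℕ) (Amax : ℕ) (v : ℝ), 0 < ε₀ →
    (∀ ε ∈ Set.Ioo 0 ε₀, BoundedBy Amax (arr ε) ∧ mean (arr ε) = (∑ n, μ n) - ε) →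
    Tendsto (fun ε => var (arr ε)) (𝓝[>] 0) (𝓝 v) →
    (∀ ε ∈ Set.Ioo 0 ε₀, (∃ π, IsStationary p (arr ε) svc π) ∧
      ∃ ρ, IsPooledStationary (arr ε) svc ρ) ∧
    ∃ L : ℝ≥0, ∀ (π : ℝ → PMF (State N)) (ρ : ℝ → PMF ℕ),
      (∀ ε ∈ Set.Ioo 0 ε₀, IsStationary p (arr ε) svc (π ε) ∧
        IsPooledStationary (arr ε) svc (ρ ε)) →
      Tendsto (fun ε => ENNReal.ofReal ε * expectedTotal (π ε)) (𝓝[>] 0) (𝓝 (L : ℝ≥0∞)) ∧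
      Tendsto (fun ε => ENNReal.ofReal ε * expectedLength (ρ ε)) (𝓝[>] 0) (𝓝 (L : ℝ≥0∞))

/-! ### Tilted distributions and the class `Π` -/

/-- `τ` lists the queues in nondecreasing order of their lengths (ties in any order). -/
def Sorts {N : ℕ} (Q : Fin N → ℕ) (τ : Equiv.Perm (Fin N)) : Prop := Monotone fun n => Q (τ n)

/-- The dispatching distribution `P_n(t) = p_{τ(n)}(t)`, in state `z`, along the ordering `τ`. -/
def sortedDispatch {N : ℕ} (p : Policy N) (t : ℕ) (z : State N) (τ : Equiv.Perm (Fin N)) :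
    Fin N → ℝ :=
  fun n => (p.dispatch t z (τ n)).toReal

/-- `Δ_n = P_n - μ_{τ(n)} / μ_Σ`. -/
def tilt {N : ℕ} (μ : Fin N → ℝ) (τ : Equiv.Perm (Fin N)) (P : Fin N → ℝ) (n : Fin N) : ℝ :=
  P n - μ (τ n) / ∑ i, μ i

/-- Equivalence in inner product: `∑ₙ Q_{τ(n)} Pₙ = ∑ₙ Q_{τ(n)} P'ₙ`. -/
def InnerEquiv {N : ℕ} (Q : Fin N → ℕ) (τ : Equiv.Perm (Fin N)) (P P' : Fin N → ℝ) : Prop :=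
  ∑ n, (Q (τ n) : ℝ) * P n = ∑ n, (Q (τ n) : ℝ) * P' n

/-- Tilted distribution: for some `k ∈ {2, …, N}`, `Δ_n ≥ 0` for `n < k` and `Δ_n ≤ 0` for `n ≥ k`.
Positions are counted from `1`, so `n : Fin N` is the position `n + 1`. -/
def IsTilted {N : ℕ} (μ : Fin N → ℝ) (τ : Equiv.Perm (Fin N)) (P : Fin N → ℝ) : Prop :=
  ∃ k : ℕ, 2 ≤ k ∧ k ≤ N ∧
    (∀ n : Fin N, (n : ℕ) + 1 < k → 0 ≤ tilt μ τ P n) ∧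
    (∀ n : Fin N, k ≤ (n : ℕ) + 1 → tilt μ τ P n ≤ 0)

/-- `δ`-tilted distribution: tilted, with `Δ_1 ≥ δ > 0` and `Δ_N ≤ -δ`. -/
def IsDeltaTilted {N : ℕ} (μ : Fin N → ℝ) (δ : ℝ) (τ : Equiv.Perm (Fin N)) (P : Fin N → ℝ) : Prop :=
  0 < δ ∧ IsTilted μ τ P ∧
    (∀ n : Fin N, (n : ℕ) = 0 → δ ≤ tilt μ τ P n) ∧
    (∀ n : Fin N, (n : ℕ) + 1 = N → tilt μ τ P n ≤ -δ)

/-- In state `z` at time `t`, for every ordering of the queues by length, `P(t)` or a probability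
vector equivalent to it in inner product is tilted (equivalence is reflexive). -/
def TiltedUpToEquiv {N : ℕ} (μ : Fin N → ℝ) (p : Policy N) (t : ℕ) (z : State N) : Prop :=
  ∀ τ, Sorts z.1 τ → ∃ P' ∈ stdSimplex ℝ (Fin N),
    InnerEquiv z.1 τ (sortedDispatch p t z τ) P' ∧ IsTilted μ τ P'

/-- The same with `δ`-tilted in place of tilted. -/
def DeltaTiltedUpToEquiv {N : ℕ} (μ : Fin N → ℝ) (δ : ℝ) (p : Policy N) (t : ℕ) (z : State N) :
    Prop :=
  ∀ τ, Sorts z.1 τ → ∃ P' ∈ stdSimplex ℝ (Fin N),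
    InnerEquiv z.1 τ (sortedDispatch p t z τ) P' ∧ IsDeltaTilted μ δ τ P'

/-- The class `Π` for servers with rates `μ`. -/
def ClassPi {N : ℕ} (μ : Fin N → ℝ) (p : Policy N) : Prop :=
  (∀ t z, TiltedUpToEquiv μ p t z) ∧
  ∃ (T : ℕ) (δ : ℝ), 0 < T ∧ 0 < δ ∧
    ∀ k : ℕ, ∃ t ∈ Set.Ico (k * T) ((k + 1) * T), ∀ z, DeltaTiltedUpToEquiv μ δ p t z

/-! ### Join-shortest-queue -/

/-- The set of the servers with the shortest queue. -/
def shortest {N : ℕ} (Q : Fin N → ℕ) : Finset (Fin N) := {n | ∀ i, Q n ≤ Q i}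

theorem shortest_nonempty {N : ℕ} [NeZero N] (Q : Fin N → ℕ) : (shortest Q).Nonempty := by
  obtain ⟨n, hn⟩ := Finite.exists_min Q
  exact ⟨n, by simpa [shortest] using hn⟩

/-- JSQ: all arrivals join a shortest queue, ties broken uniformly at random; no memory is kept. -/
def jsq (N : ℕ) [NeZero N] : Policy N where
  dispatch := fun _ z => PMF.uniformOfFinset (shortest z.1) (shortest_nonempty z.1)
  updateMemory := fun _ _ _ _ _ => PMF.pure ∅

/-- `μ_min`, the smallest service rate. -/
def minRate {N : ℕ} [NeZero N] (μ : Fin N → ℝ) : ℝ := Finset.univ.inf' Finset.univ_nonempty μ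

end LoadBalancing

end

namespace LoadBalancing

/-! ### Expectations of `[0, ∞]`-valued functions under a discrete law -/

/-! JSQ charges only shortest queues, so its inner product with the queue lengths is the minimal
length, the same as for the point mass on the first position of the ordering. That point mass is
tilted with `k = 2`, and `N ≥ 2` supplies the margin: one server other than the first has rate at
least `minRate μ`. This settles membership in `Π`; both optimality statements are then proved for
JSQ directly.

Stability rests on the drift of `size ^ 2` (`size_drift`). The shortest queue is at most the
`μ`-weighted mean length, so the drift is at most a constant minus a multiple of `size`. Increments
are bounded, so `exists_exp_drift` turns this into a geometric drift of `exp (θ * size)`. This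
yields stationary laws (`exists_stationary`), tightness from any initial law, and finite second
moments in stationarity.

For heavy traffic let `q` be the total queue, `a`, `s` the arrivals and total service, `U` the
unused service, `q'` the next total and `ε` the gap between service and arrival rates, so that `q' +
s = q + a + U`. Equating first and second moments in stationarity gives `E U = ε` and `E U² + 2 ε E
q + 2 E a E s = E a² + E s² + 2 E (q' U)`. Since `U` is bounded, `E U² = O(ε)`. The pooled queue has
`q' U = 0`, so it remains to show that `E (q' U)` vanishes for JSQ as well. Unused service means
that some queue is empty, whence `q'` is at most `2 N` times the dispersion. Near capacity the
dispersion has a negative drift whose rate does not depend on `ε` (`dispersion_drift`), hence a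
uniformly bounded second moment (`exists_dispersion_bound`), and `E (q' U) = O(√ε)`. Both limits
equal half the sum of the limiting arrival variance and the variance of the total service. -/

/-- The expectation of a `[0, ∞]`-valued function under a discrete law. -/
noncomputable def expect {α : Type*} (p : PMF α) (f : α → ℝ≥0∞) : ℝ≥0∞ := ∑' x, p x * f x

section Expect

variable {α β : Type*}

theorem expect_bind (p : PMF α) (k : α → PMF β) (f : β → ℝ≥0∞) :
    expect (p.bind k) f = expect p fun x => expect (k x) f := by
  simp only [expect, PMF.bind_apply, ← ENNReal.tsum_mul_right, ← ENNReal.tsum_mul_left]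
  rw [ENNReal.tsum_comm]
  simp only [mul_assoc]

theorem expect_pure (x : α) (f : α → ℝ≥0∞) : expect (PMF.pure x) f = f x := by
  rw [expect, tsum_eq_single x]
  · simp
  · intro y hy
    simp [hy]

theorem expect_map (p : PMF α) (g : α → β) (f : β → ℝ≥0∞) :
    expect (p.map g) f = expect p fun x => f (g x) := by
  simp [PMF.map, expect_bind, expect_pure]

theorem expect_congr {p : PMF α} {f g : α → ℝ≥0∞} (h : ∀ x ∈ p.support, f x = g x) :
    expect p f = expect p g := by
  refine tsum_congr fun x => ?_
  by_cases hx : p x = 0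
  · simp [hx]
  · rw [h x hx]

theorem expect_mono {p : PMF α} {f g : α → ℝ≥0∞} (h : ∀ x ∈ p.support, f x ≤ g x) :
    expect p f ≤ expect p g := by
  refine ENNReal.tsum_le_tsum fun x => ?_
  by_cases hx : p x = 0
  · simp [hx]
  · gcongr
    exact h x hx

theorem expect_add (p : PMF α) (f g : α → ℝ≥0∞) :
    expect p (fun x => f x + g x) = expect p f + expect p g := by
  simp [expect, mul_add, ENNReal.tsum_add]

theorem expect_const_mul (p : PMF α) (c : ℝ≥0∞) (f : α → ℝ≥0∞) :
    expect p (fun x => c * f x) = c * expect p f := by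
  simp only [expect, ← ENNReal.tsum_mul_left]
  exact tsum_congr fun x => by ring

theorem expect_mul_const (p : PMF α) (c : ℝ≥0∞) (f : α → ℝ≥0∞) :
    expect p (fun x => f x * c) = expect p f * c := by
  simp only [mul_comm _ c, expect_const_mul]

theorem expect_const (p : PMF α) (c : ℝ≥0∞) : expect p (fun _ => c) = c := by
  simp [expect, ENNReal.tsum_mul_right, p.tsum_coe]

theorem expect_finset_sum {ι : Type*} (p : PMF α) (s : Finset ι) (f : ι → α → ℝ≥0∞) :
    expect p (fun x => ∑ i ∈ s, f i x) = ∑ i ∈ s, expect p (f i) := by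
  simp only [expect, Finset.mul_sum]
  exact Summable.tsum_finsetSum fun _ _ => ENNReal.summable

theorem expect_le_of_le {p : PMF α} {f : α → ℝ≥0∞} {c : ℝ≥0∞} (h : ∀ x ∈ p.support, f x ≤ c) :
    expect p f ≤ c :=
  (expect_mono h).trans_eq (expect_const p c)

theorem toOuterMeasure_eq_expect (p : PMF α) (s : Set α) :
    p.toOuterMeasure s = expect p (s.indicator 1) := by
  classical
  rw [PMF.toOuterMeasure_apply]
  refine tsum_congr fun x => ?_
  by_cases hx : x ∈ s <;> simp [hx]

/-- Integration of an affine inequality between real functions. -/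
theorem expect_affine {p : PMF α} {f g : α → ℝ} {b c d e G : ℝ} (hb : 0 ≤ b) (hc : 0 ≤ c)
    (hd : 0 ≤ d) (he : 0 ≤ e) (hG : 0 ≤ G) (hf : ∀ x, 0 ≤ f x)
    (hg : ∀ x, 0 ≤ g x) (h : ∀ x ∈ p.support, f x + d ≤ c * g x + b)
    (hE : expect p (fun x => ENNReal.ofReal (g x)) + ENNReal.ofReal e ≤ ENNReal.ofReal G) :
    expect p (fun x => ENNReal.ofReal (f x)) ≤ ENNReal.ofReal (c * G + b - (d + c * e)) := by
  have h1 : expect p (fun x => ENNReal.ofReal (f x)) + ENNReal.ofReal d ≤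
      ENNReal.ofReal c * expect p (fun x => ENNReal.ofReal (g x)) + ENNReal.ofReal b := by
    rw [← expect_const p (ENNReal.ofReal d), ← expect_const p (ENNReal.ofReal b), ← expect_add,
      ← expect_const_mul, ← expect_add]
    refine expect_mono fun x hx => ?_
    rw [← ENNReal.ofReal_add (hf x) hd, ← ENNReal.ofReal_mul hc,
      ← ENNReal.ofReal_add (mul_nonneg hc (hg x)) hb]
    exact ENNReal.ofReal_le_ofReal (h x hx)
  rw [ENNReal.ofReal_sub _ (by positivity)]
  refine ENNReal.le_sub_of_add_le_right ENNReal.ofReal_ne_top ?_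
  rw [ENNReal.ofReal_add hd (by positivity), ENNReal.ofReal_add (by positivity) hb,
    ENNReal.ofReal_mul hc, ENNReal.ofReal_mul hc, ← add_assoc]
  calc _ ≤ ENNReal.ofReal c * expect p (fun x => ENNReal.ofReal (g x)) + ENNReal.ofReal b +
        ENNReal.ofReal c * ENNReal.ofReal e := by gcongr
    _ = ENNReal.ofReal c * (expect p (fun x => ENNReal.ofReal (g x)) + ENNReal.ofReal e) +
        ENNReal.ofReal b := by ring
    _ ≤ _ := by gcongr

end Expect

/-! ### Lyapunov functions for Markov chains on countable spaces -/

section Lyapunov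

variable {α : Type*}

/-- Foster's moment bound: if `K V + g ≤ V + C`, then every stationary law gives `g` an expectation
of at most `C`. -/
theorem expect_le_of_drift {K : α → PMF α} {V g : α → ℝ≥0∞} {C : ℝ≥0∞} (hV : ∀ z, V z ≠ ⊤)
    (hdrift : ∀ z, expect (K z) V + g z ≤ V z + C) {π : PMF α} (hπ : π.bind K = π) :
    expect π g ≤ C := by
  classical
  -- `V` need not be integrable under `π`, so it is truncated at `M`; the expectation of `min V M`
  -- is finite and can be cancelled. Where `V > M` the truncation equals `M` and cannot increase.
  have key : ∀ M : ℝ≥0∞, M ≠ ⊤ → expect π (fun z => if V z ≤ M then g z else 0) ≤ C := by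
    intro M hM
    have hfin : expect π (fun z => min (V z) M) ≠ ⊤ :=
      ne_top_of_le_ne_top hM (expect_le_of_le fun z _ => min_le_right _ _)
    have h1 : expect π (fun z => min (V z) M) + expect π (fun z => if V z ≤ M then g z else 0) ≤
        expect π (fun z => min (V z) M) + C := by
      conv_lhs => rw [← hπ, expect_bind, hπ]
      rw [← expect_const π C, ← expect_add, ← expect_add]
      refine expect_mono fun z _ => ?_
      have hb : expect (K z) (fun z => min (V z) M) ≤ min (expect (K z) V) M :=
        le_min (expect_mono fun _ _ => min_le_left _ _) (expect_le_of_le fun _ _ => min_le_right _ _)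
      split_ifs with hz
      · rw [min_eq_left hz]
        exact (add_le_add_left (hb.trans (min_le_left _ _)) _).trans (hdrift z)
      · rw [min_eq_right (le_of_not_ge hz), add_zero]
        exact (hb.trans (min_le_right _ _)).trans le_self_add
    exact (ENNReal.add_le_add_iff_left hfin).1 h1
  rw [expect, ENNReal.tsum_eq_iSup_sum]
  refine iSup_le fun s => ?_
  have hM : (∑ z ∈ s, V z) ≠ ⊤ := ENNReal.sum_ne_top.2 fun z _ => hV z
  refine le_trans ?_ (key _ hM)
  refine le_trans (Finset.sum_le_sum fun z hz => ?_) (ENNReal.sum_le_tsum s)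
  simp only [if_pos (Finset.single_le_sum (fun _ _ => zero_le) hz : V z ≤ ∑ z ∈ s, V z), le_refl]

/-- A drift condition for the square of a function with bounded increments gives a geometric drift
condition for its exponential, with constants that depend on the given constants only. -/
theorem exists_exp_drift {η K₀ B : ℝ} (hη : 0 < η) (hK : 0 ≤ K₀) (hB : 0 < B) :
    ∃ θ c C : ℝ, 0 < θ ∧ 0 < c ∧ c < 1 ∧ 0 ≤ C ∧ ∀ (p : PMF α) (R : α → ℝ) (r : ℝ),
      (∀ z, 0 ≤ R z) → 0 ≤ r → (∀ z ∈ p.support, |R z - r| ≤ B) →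
      expect p (fun z => ENNReal.ofReal (R z ^ 2)) + ENNReal.ofReal (2 * η * r) ≤
        ENNReal.ofReal (r ^ 2 + K₀) →
      expect p (fun z => ENNReal.ofReal (Real.exp (θ * R z))) ≤
        ENNReal.ofReal ((1 - c) * Real.exp (θ * r) + C) := by
  -- The first bound makes `|exp x - 1 - x| ≤ x ^ 2` available for `x = θ (R - r)`, the second
  -- absorbs the quadratic error into the drift, and the third keeps `c = θ * η / 4` below one.
  obtain ⟨θ, hθ, h1, h2, h3⟩ : ∃ θ : ℝ, 0 < θ ∧ θ * B ≤ 1 ∧ θ * B ^ 2 ≤ η / 4 ∧ θ * η < 1 := by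
    refine ⟨min (1 / B) (min (η / 4 / B ^ 2) (1 / (2 * η))), by positivity, ?_, ?_, ?_⟩
    · exact (le_div_iff₀ hB).1 (min_le_left _ _)
    · exact (le_div_iff₀ (by positivity)).1 ((min_le_right _ _).trans (min_le_left _ _))
    · have := (le_div_iff₀ (by positivity)).1 ((min_le_right (1 / B) _).trans
        (min_le_right (η / 4 / B ^ 2) (1 / (2 * η))))
      linarith
  refine ⟨θ, θ * η / 4, Real.exp (θ * (K₀ / η + B)), hθ, by positivity, by linarith, by positivity,
    ?_⟩
  intro p R r hR hr hinc hdrift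
  have hc1 : 0 ≤ 1 - θ * η / 4 := by linarith
  -- Below the level `K₀ / η` the drift may be positive, but `R ≤ K₀ / η + B` there, which the
  -- constant `C` covers.
  rcases le_total r (K₀ / η) with hle | hge
  · refine expect_le_of_le fun z hz => ENNReal.ofReal_le_ofReal ?_
    have : R z ≤ K₀ / η + B := by linarith [(abs_le.1 (hinc z hz)).2]
    have h4 : Real.exp (θ * R z) ≤ Real.exp (θ * (K₀ / η + B)) := by gcongr
    have : 0 ≤ (1 - θ * η / 4) * Real.exp (θ * r) := by positivity
    linarith
  -- The main case divides by `r`; `r = 0` survives here only if `K₀ = 0`.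
  rcases hr.eq_or_lt with rfl | hr0
  · refine expect_le_of_le fun z hz => ENNReal.ofReal_le_ofReal ?_
    have hz0 : R z ≤ B := by linarith [(abs_le.1 (hinc z hz)).2]
    have : R z ≤ K₀ / η + B := by linarith [div_nonneg hK hη.le]
    have h4 : Real.exp (θ * R z) ≤ Real.exp (θ * (K₀ / η + B)) := by gcongr
    have : 0 ≤ (1 - θ * η / 4) * Real.exp (θ * 0) := by positivity
    linarith
  have hKr : K₀ ≤ η * r := by rwa [div_le_iff₀' hη] at hge
  set E := Real.exp (θ * r) with hE
  have hE0 : 0 < E := Real.exp_pos _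
  -- From `(R - r)² ≥ 0` one gets `R - r ≤ (R² - r²) / (2 r)`, which trades the linear term of the
  -- exponential for the square, whose drift is known.
  have hpt : ∀ z ∈ p.support, Real.exp (θ * R z) + E * (θ * r / 2) ≤
      E * (θ / (2 * r)) * R z ^ 2 + E * (1 + θ ^ 2 * B ^ 2) := by
    intro z hz
    have hx := hinc z hz
    have habs : |θ * (R z - r)| ≤ 1 := by
      rw [abs_mul, abs_of_pos hθ]
      exact (mul_le_mul_of_nonneg_left hx hθ.le).trans h1
    have hexp := (abs_le.1 (Real.abs_exp_sub_one_sub_id_le habs)).2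
    have hsq : (θ * (R z - r)) ^ 2 ≤ θ ^ 2 * B ^ 2 := by
      rw [mul_pow]
      gcongr θ ^ 2 * ?_
      exact sq_le_sq.2 (by rwa [abs_of_pos hB])
    have hlin : θ * (R z - r) ≤ θ / (2 * r) * R z ^ 2 - θ * r / 2 := by
      have : θ / (2 * r) * R z ^ 2 - θ * r / 2 - θ * (R z - r) = θ / (2 * r) * (R z - r) ^ 2 := by
        field_simp
        ring
      have : 0 ≤ θ / (2 * r) * (R z - r) ^ 2 := by positivity
      linarith
    have hsplit : Real.exp (θ * R z) = E * Real.exp (θ * (R z - r)) := by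
      rw [hE, ← Real.exp_add]
      ring_nf
    have : Real.exp (θ * (R z - r)) + θ * r / 2 ≤
        θ / (2 * r) * R z ^ 2 + (1 + θ ^ 2 * B ^ 2) := by linarith
    rw [hsplit]
    nlinarith
  refine (expect_affine (by positivity) (by positivity) (by positivity) (by positivity)
    (by positivity) (fun z => (Real.exp_pos _).le) (fun z => sq_nonneg _) hpt hdrift).trans ?_
  refine ENNReal.ofReal_le_ofReal ?_
  have hid : E * (θ / (2 * r)) * (r ^ 2 + K₀) + E * (1 + θ ^ 2 * B ^ 2) -
      (E * (θ * r / 2) + E * (θ / (2 * r)) * (2 * η * r)) =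
      E * (1 + θ * (θ * B ^ 2) - θ * η + θ * (K₀ / (2 * r))) := by
    field_simp
    ring
  rw [hid]
  -- Of the gain `θ * η`, the constant `K₀` costs at most one half and the quadratic error at most
  -- one quarter; one quarter remains.
  have h5 : K₀ / (2 * r) ≤ η / 2 := by
    rw [div_le_iff₀ (by positivity)]
    linarith
  have h6 : θ * (K₀ / (2 * r)) ≤ θ * (η / 2) := by gcongr
  have h7 : θ * (θ * B ^ 2) ≤ θ * (η / 4) := by gcongr
  have h8 : E * (1 + θ * (θ * B ^ 2) - θ * η + θ * (K₀ / (2 * r))) ≤ E * (1 - θ * η / 4) := by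
    gcongr
    linarith
  have : 0 < Real.exp (θ * (K₀ / η + B)) := Real.exp_pos _
  linarith

/-- Under a geometric drift condition, stationary laws have a bounded expectation. -/
theorem expect_le_of_geometric_drift {K : α → PMF α} {f : α → ℝ} {c C : ℝ} (hc : 0 < c)
    (hc1 : c < 1) (hC : 0 ≤ C) (hf : ∀ z, 0 ≤ f z)
    (hdrift : ∀ z, expect (K z) (fun z => ENNReal.ofReal (f z)) ≤
      ENNReal.ofReal ((1 - c) * f z + C)) {π : PMF α} (hπ : π.bind K = π) :
    expect π (fun z => ENNReal.ofReal (f z)) ≤ ENNReal.ofReal (C / c) := by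
  have h := expect_le_of_drift (V := fun z => ENNReal.ofReal (f z))
    (g := fun z => ENNReal.ofReal c * ENNReal.ofReal (f z)) (C := ENNReal.ofReal C)
    (fun z => ENNReal.ofReal_ne_top) (fun z => ?_) hπ
  · rw [expect_const_mul] at h
    rw [ENNReal.ofReal_div_of_pos hc,
      ENNReal.le_div_iff_mul_le (Or.inl (by simpa using hc)) (Or.inl ENNReal.ofReal_ne_top), mul_comm]
    exact h
  · have h1 : 0 ≤ 1 - c := by linarith
    have h2 := hf z
    refine (add_le_add_left (hdrift z) _).trans_eq ?_
    rw [← ENNReal.ofReal_mul hc.le, ← ENNReal.ofReal_add (by positivity) (by positivity),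
      ← ENNReal.ofReal_add h2 hC]
    ring_nf

/-- The law after `t` steps of the homogeneous chain with kernel `K`. -/
noncomputable def iterLaw (K : α → PMF α) (init : PMF α) : ℕ → PMF α
  | 0 => init
  | t + 1 => (iterLaw K init t).bind K

/-- Conditioning on the initial state: an arbitrary initial law need not integrate the Lyapunov
function, a point mass does. -/
theorem iterLaw_eq_bind (K : α → PMF α) (init : PMF α) (t : ℕ) :
    iterLaw K init t = init.bind fun z => iterLaw K (PMF.pure z) t := by
  induction t with
  | zero => simp [iterLaw]
  | succ t ih =>
    rw [iterLaw, ih, PMF.bind_bind]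
    rfl

/-- The affine map `x ↦ (1 - c) x + C` sends `f z₀ + C / c` to at most itself, so the bound
propagates through all times. -/
theorem expect_iterLaw_pure_le {K : α → PMF α} {f : α → ℝ} {c C : ℝ} (hc : 0 < c)
    (hc1 : c < 1) (hC : 0 ≤ C) (hf : ∀ z, 0 ≤ f z)
    (hdrift : ∀ z, expect (K z) (fun z => ENNReal.ofReal (f z)) ≤
      ENNReal.ofReal ((1 - c) * f z + C)) (z₀ : α) (t : ℕ) :
    expect (iterLaw K (PMF.pure z₀) t) (fun z => ENNReal.ofReal (f z)) ≤
      ENNReal.ofReal (f z₀ + C / c) := by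
  have h1 : 0 ≤ 1 - c := by linarith
  have h0 := hf z₀
  induction t with
  | zero =>
    rw [iterLaw, expect_pure]
    exact ENNReal.ofReal_le_ofReal (by linarith [div_nonneg hC hc.le])
  | succ t ih =>
    rw [iterLaw, expect_bind]
    calc _ ≤ expect (iterLaw K (PMF.pure z₀) t) (fun z => ENNReal.ofReal (1 - c) *
            ENNReal.ofReal (f z) + ENNReal.ofReal C) := by
          refine expect_mono fun z _ => (hdrift z).trans_eq ?_
          rw [ENNReal.ofReal_add (mul_nonneg h1 (hf z)) hC, ENNReal.ofReal_mul h1]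
      _ ≤ ENNReal.ofReal (1 - c) * ENNReal.ofReal (f z₀ + C / c) + ENNReal.ofReal C := by
          rw [expect_add, expect_const_mul, expect_const]
          gcongr
      _ ≤ _ := by
          rw [← ENNReal.ofReal_mul h1, ← ENNReal.ofReal_add (by positivity) hC]
          refine ENNReal.ofReal_le_ofReal ?_
          have : (1 - c) * (f z₀ + C / c) + C = f z₀ + C / c - c * f z₀ := by
            field_simp
            ring
          nlinarith

/-- A chain that satisfies a geometric drift condition for a function with finite sublevel sets has a
stationary law. -/
theorem exists_stationary [Nonempty α] {K : α → PMF α} {f : α → ℝ} {c C : ℝ} (hc : 0 < c)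
    (hc1 : c < 1) (hC : 0 ≤ C) (hf : ∀ z, 0 ≤ f z) (hfin : ∀ b : ℝ, {z | f z ≤ b}.Finite)
    (hdrift : ∀ z, expect (K z) (fun z => ENNReal.ofReal (f z)) ≤
      ENNReal.ofReal ((1 - c) * f z + C)) : ∃ π : PMF α, π.bind K = π := by
  classical
  obtain ⟨z₀⟩ := ‹Nonempty α›
  set D := f z₀ + C / c with hD
  have hD0 : 0 ≤ D := by have := hf z₀; positivity
  set ℓ := iterLaw K (PMF.pure z₀) with hℓ
  -- Krylov–Bogoliubov: Cesàro averages of the laws started from `z₀`. Since `[0, ∞]` is compact,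
  -- they converge at every state simultaneously along a free ultrafilter.
  set ν : ℕ → α → ℝ≥0∞ := fun n z => ((n : ℝ≥0∞) + 1)⁻¹ * ∑ t ∈ Finset.range (n + 1), ℓ t z with hν
  set U : Ultrafilter ℕ := hyperfilter ℕ
  have hn0 : ∀ n : ℕ, (n : ℝ≥0∞) + 1 ≠ 0 := fun n => by simp
  have hnT : ∀ n : ℕ, (n : ℝ≥0∞) + 1 ≠ ⊤ := fun n => by simp
  have hex : ∀ z, ∃ x, Tendsto (fun n => ν n z) U (𝓝 x) := fun z => by
    obtain ⟨x, -, hx⟩ := isCompact_univ.ultrafilter_le_nhds (U.map fun n => ν n z) (by simp)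
    exact ⟨x, hx⟩
  choose p hp using hex
  have hsum : ∀ (s : Finset α) (g : α → ℝ≥0∞), (∀ z, g z ≠ ⊤) →
      Tendsto (fun n => ∑ z ∈ s, ν n z * g z) U (𝓝 (∑ z ∈ s, p z * g z)) := fun s g hg =>
    tendsto_finsetSum _ fun z _ => ENNReal.Tendsto.mul_const (hp z) (Or.inr (hg z))
  have hsum1 : ∀ s : Finset α, Tendsto (fun n => ∑ z ∈ s, ν n z) U (𝓝 (∑ z ∈ s, p z)) := fun s => by
    simpa using hsum s 1 (by simp)
  have hmass : ∀ n, ∑' z, ν n z = 1 := fun n => by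
    simp only [hν]
    rw [ENNReal.tsum_mul_left, Summable.tsum_finsetSum fun _ _ => ENNReal.summable]
    simp only [PMF.tsum_coe, Finset.sum_const, Finset.card_range, nsmul_eq_mul, mul_one,
      Nat.cast_add, Nat.cast_one]
    exact ENNReal.inv_mul_cancel (hn0 n) (hnT n)
  have hle1 : ∑' z, p z ≤ 1 := by
    rw [ENNReal.tsum_eq_iSup_sum]
    refine iSup_le fun s => le_of_tendsto (hsum1 s) (Eventually.of_forall fun n => ?_)
    exact (ENNReal.sum_le_tsum s).trans_eq (hmass n)
  -- Markov's inequality: mass at most `D / b` lies outside the finite set `{f ≤ b}`, uniformly in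
  -- `n`. Hence no mass is lost in the limit.
  have htight : ∀ b : ℝ, 0 < b → ∀ n, 1 ≤ ∑ z ∈ (hfin b).toFinset, ν n z + ENNReal.ofReal (D / b) := by
    intro b hb n
    have h1 : ∀ t, 1 ≤ ∑ z ∈ (hfin b).toFinset, ℓ t z + ENNReal.ofReal (D / b) := by
      intro t
      have h2 : expect (ℓ t) (fun _ => 1) ≤ expect (ℓ t) (fun z =>
          (if z ∈ (hfin b).toFinset then 1 else 0) + ENNReal.ofReal b⁻¹ * ENNReal.ofReal (f z)) := by
        refine expect_mono fun z _ => ?_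
        split_ifs with hz
        · exact le_self_add
        · have hz' : b < f z := by simpa using hz
          rw [zero_add, ← ENNReal.ofReal_mul (by positivity), ← ENNReal.ofReal_one]
          refine ENNReal.ofReal_le_ofReal ?_
          rw [inv_mul_eq_div, le_div_iff₀ hb]
          linarith
      rw [expect_const, expect_add, expect_const_mul] at h2
      refine h2.trans (add_le_add ?_ ?_)
      · rw [expect, tsum_eq_sum (s := (hfin b).toFinset) fun z hz => by simp only [if_neg hz, mul_zero]]
        exact Finset.sum_le_sum fun z hz => by simp only [if_pos hz, mul_one, le_refl]
      · refine (mul_le_mul_right (expect_iterLaw_pure_le hc hc1 hC hf hdrift z₀ t) _).trans_eq ?_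
        rw [← ENNReal.ofReal_mul (by positivity), inv_mul_eq_div]
    calc (1 : ℝ≥0∞) = ((n : ℝ≥0∞) + 1)⁻¹ * ∑ t ∈ Finset.range (n + 1), 1 := by
          simp [ENNReal.inv_mul_cancel (hn0 n) (hnT n)]
      _ ≤ ((n : ℝ≥0∞) + 1)⁻¹ * ∑ t ∈ Finset.range (n + 1),
          (∑ z ∈ (hfin b).toFinset, ℓ t z + ENNReal.ofReal (D / b)) := by
          gcongr with t _
          exact h1 t
      _ = _ := by
          rw [Finset.sum_add_distrib, mul_add, Finset.sum_comm, Finset.mul_sum]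
          congr 1
          simp [← mul_assoc, ENNReal.inv_mul_cancel (hn0 n) (hnT n)]
  have hge1 : 1 ≤ ∑' z, p z := by
    have hlim : Tendsto (fun b : ℝ => ∑' z, p z + ENNReal.ofReal (D / b)) atTop
        (𝓝 (∑' z, p z + ENNReal.ofReal 0)) :=
      tendsto_const_nhds.add (ENNReal.tendsto_ofReal (tendsto_const_nhds.div_atTop tendsto_id))
    rw [ENNReal.ofReal_zero, add_zero] at hlim
    refine ge_of_tendsto hlim ((eventually_gt_atTop 0).mono fun b hb => ?_)
    refine le_trans ?_ (add_le_add_left (ENNReal.sum_le_tsum (hfin b).toFinset) _)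
    exact ge_of_tendsto ((hsum1 _).add_const _) (Eventually.of_forall (htight b hb))
  have hone : ∑' z, p z = 1 := le_antisymm hle1 hge1
  let π : PMF α := ⟨p, hone ▸ ENNReal.summable.hasSum⟩
  refine ⟨π, ?_⟩
  -- Applying `K` shifts the sum by one step; the one extra term is at most `1` and is killed by the
  -- factor `1 / (n + 1)`.
  have hstep : ∀ n y, ∑' z, ν n z * K z y ≤ ν n y + ((n : ℝ≥0∞) + 1)⁻¹ := by
    intro n y
    calc ∑' z, ν n z * K z y = ((n : ℝ≥0∞) + 1)⁻¹ * ∑ t ∈ Finset.range (n + 1), ℓ (t + 1) y := by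
          simp only [hν, mul_assoc, Finset.sum_mul]
          rw [ENNReal.tsum_mul_left, Summable.tsum_finsetSum fun _ _ => ENNReal.summable]
          rfl
      _ ≤ ((n : ℝ≥0∞) + 1)⁻¹ * (∑ t ∈ Finset.range (n + 1), ℓ t y + 1) := by
          gcongr
          refine le_trans (b := ∑ t ∈ Finset.range (n + 1 + 1), ℓ t y) ?_ ?_
          · rw [Finset.sum_range_succ' _ (n + 1)]
            exact le_self_add
          · rw [Finset.sum_range_succ _ (n + 1)]
            gcongr
            exact PMF.coe_le_one _ _
      _ = _ := by rw [mul_add, mul_one]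
  have hinv0 : Tendsto (fun n : ℕ => ((n : ℝ≥0∞) + 1)⁻¹) U (𝓝 0) := by
    have : Tendsto (fun n : ℕ => ((n + 1 : ℕ) : ℝ≥0∞)⁻¹) atTop (𝓝 0) :=
      (tendsto_add_atTop_iff_nat (f := fun n : ℕ => (n : ℝ≥0∞)⁻¹) 1).2
        ENNReal.tendsto_inv_nat_nhds_zero
    simp only [Nat.cast_add, Nat.cast_one] at this
    exact this.mono_left (by rw [← Nat.cofinite_eq_atTop]; exact hyperfilter_le_cofinite)
  have hsub : ∀ y, π.bind K y ≤ π y := by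
    intro y
    rw [PMF.bind_apply, ENNReal.tsum_eq_iSup_sum]
    refine iSup_le fun s => ?_
    have hl := (hp y).add hinv0
    rw [add_zero] at hl
    refine le_of_tendsto_of_tendsto (hsum s (fun z => K z y) fun z => PMF.apply_ne_top _ _) hl
      (Eventually.of_forall fun n => ?_)
    exact (ENNReal.sum_le_tsum s).trans (hstep n y)
  -- `π.bind K ≤ π` pointwise and both have total mass one, so a strict inequality at one state
  -- would give `1 < 1`.
  ext y
  by_contra hne
  have hlt : π.bind K y < π y := lt_of_le_of_ne (hsub y) hne
  have := ENNReal.tsum_lt_tsum (by rw [PMF.tsum_coe]; simp) hsub hlt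
  rw [PMF.tsum_coe, PMF.tsum_coe] at this
  exact lt_irrefl _ this

end Lyapunov

/-! ### Moments of the arrivals and of the services -/

section Moments

variable {N : ℕ}

theorem lintegral_toMeasure_eq_expect (p : PMF ℕ) (f : ℕ → ℝ≥0∞) :
    ∫⁻ k, f k ∂p.toMeasure = expect p f := by
  rw [lintegral_countable']
  exact tsum_congr fun k => by
    rw [p.toMeasure_apply_singleton k (measurableSet_singleton k), mul_comm]

theorem expect_ne_top_of_boundedBy {p : PMF ℕ} {b : ℕ} (h : BoundedBy b p) (i : ℕ) :
    expect p (fun k => (k : ℝ≥0∞) ^ i) ≠ ⊤ := by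
  refine ne_top_of_le_ne_top (b := (b : ℝ≥0∞) ^ i) (by simp) (expect_le_of_le fun k hk => ?_)
  gcongr
  exact h k hk

theorem mean_eq_toReal (p : PMF ℕ) : mean p = (expect p fun k => (k : ℝ≥0∞)).toReal := by
  rw [mean, integral_eq_lintegral_of_nonneg_ae (ae_of_all _ fun k => by simp)
    (Measurable.of_discrete).aestronglyMeasurable]
  simp [lintegral_toMeasure_eq_expect]

theorem mean_nonneg (p : PMF ℕ) : 0 ≤ mean p := by
  rw [mean_eq_toReal]
  exact ENNReal.toReal_nonneg

theorem expect_eq_ofReal_mean {p : PMF ℕ} {b : ℕ} (h : BoundedBy b p) :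
    expect p (fun k => (k : ℝ≥0∞)) = ENNReal.ofReal (mean p) := by
  rw [mean_eq_toReal, ENNReal.ofReal_toReal]
  simpa using expect_ne_top_of_boundedBy h 1

theorem expect_sq_eq_ofReal {p : PMF ℕ} {b : ℕ} (h : BoundedBy b p) :
    expect p (fun k => (k : ℝ≥0∞) ^ 2) = ENNReal.ofReal (var p + mean p ^ 2) := by
  have hmem : MemLp (fun k : ℕ => (k : ℝ)) 2 p.toMeasure := by
    refine MemLp.of_bound (Measurable.of_discrete).aestronglyMeasurable (b : ℝ) ?_
    rw [ae_iff, PMF.toMeasure_apply_eq_zero_iff _ (MeasurableSet.of_discrete),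
      Set.disjoint_left]
    intro k hk hk'
    simp only [Real.norm_natCast, Nat.cast_le, Set.mem_ofPred_eq] at hk'
    exact hk' (h k hk)
  rw [var, variance_eq_sub hmem, mean, sub_add_cancel,
    integral_eq_lintegral_of_nonneg_ae (ae_of_all _ fun k => by simp)
    (Measurable.of_discrete).aestronglyMeasurable]
  simp only [Pi.pow_apply, lintegral_toMeasure_eq_expect]
  simp only [ENNReal.ofReal_pow (Nat.cast_nonneg _), ENNReal.ofReal_natCast]
  rw [ENNReal.ofReal_toReal (expect_ne_top_of_boundedBy h 2)]

theorem expect_serviceLaw_eval (svc : Fin N → PMF ℕ) (n : Fin N) (f : ℕ → ℝ≥0∞) :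
    expect (serviceLaw svc) (fun S => f (S n)) = expect (svc n) f := by
  have h := (measurePreserving_eval (fun n => (svc n).toMeasure) n).lintegral_comp
    (f := f) (Measurable.of_discrete)
  rw [lintegral_toMeasure_eq_expect] at h
  rw [← h, lintegral_countable']
  exact tsum_congr fun S => mul_comm _ _

theorem mem_support_of_mem_serviceLaw {svc : Fin N → PMF ℕ} {S : Fin N → ℕ}
    (hS : S ∈ (serviceLaw svc).support) (n : Fin N) : S n ∈ (svc n).support := by
  rw [PMF.mem_support_iff, serviceLaw, Measure.toPMF_apply, Measure.pi_singleton,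
    Finset.prod_ne_zero_iff] at hS
  simpa [PMF.toMeasure_apply_singleton] using hS n (Finset.mem_univ n)

/-- The randomness of one slot: arrivals, services and dispatching decision. -/
noncomputable def slotLaw (arr : PMF ℕ) (svc : Fin N → PMF ℕ) (d : PMF (Fin N)) :
    PMF (ℕ × (Fin N → ℕ) × Fin N) :=
  arr.bind fun a => (serviceLaw svc).bind fun S => d.map fun s => (a, S, s)

theorem expect_slotLaw (arr : PMF ℕ) (svc : Fin N → PMF ℕ) (d : PMF (Fin N))
    (f : ℕ × (Fin N → ℕ) × Fin N → ℝ≥0∞) :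
    expect (slotLaw arr svc d) f =
      expect arr fun a => expect (serviceLaw svc) fun S => expect d fun s => f (a, S, s) := by
  simp only [slotLaw, expect_bind, expect_map]

theorem mem_support_slotLaw {arr : PMF ℕ} {svc : Fin N → PMF ℕ} {d : PMF (Fin N)}
    {ω : ℕ × (Fin N → ℕ) × Fin N} (h : ω ∈ (slotLaw arr svc d).support) :
    ω.1 ∈ arr.support ∧ (∀ n, ω.2.1 n ∈ (svc n).support) ∧ ω.2.2 ∈ d.support := by
  simp only [slotLaw, PMF.mem_support_bind_iff, PMF.mem_support_map_iff] at h
  obtain ⟨a, ha, S, hS, s, hs, rfl⟩ := h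
  exact ⟨ha, mem_support_of_mem_serviceLaw hS, hs⟩

/-- The bounded data of a slot, with arrival rate `lam` and service rates `μ`. -/
structure SlotBounds (arr : PMF ℕ) (svc : Fin N → PMF ℕ) (μ : Fin N → ℝ) (lam : ℝ) (M : ℕ) :
    Prop where
  arr_le : BoundedBy M arr
  svc_le : ∀ n, BoundedBy M (svc n)
  arr_mean : mean arr = lam
  svc_mean : ∀ n, mean (svc n) = μ n

variable {arr : PMF ℕ} {svc : Fin N → PMF ℕ} {μ : Fin N → ℝ} {lam : ℝ} {M : ℕ}

theorem SlotBounds.lam_nonneg (h : SlotBounds arr svc μ lam M) : 0 ≤ lam :=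
  h.arr_mean ▸ mean_nonneg arr

theorem SlotBounds.mu_nonneg (h : SlotBounds arr svc μ lam M) (n : Fin N) : 0 ≤ μ n :=
  h.svc_mean n ▸ mean_nonneg _

theorem SlotBounds.expect_arrivals (h : SlotBounds arr svc μ lam M) (d : PMF (Fin N)) :
    expect (slotLaw arr svc d) (fun ω => (ω.1 : ℝ≥0∞)) = ENNReal.ofReal lam := by
  simp only [expect_slotLaw, expect_const]
  rw [expect_eq_ofReal_mean h.arr_le, h.arr_mean]

theorem SlotBounds.expect_service (h : SlotBounds arr svc μ lam M) (d : PMF (Fin N)) (n : Fin N) :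
    expect (slotLaw arr svc d) (fun ω => (ω.2.1 n : ℝ≥0∞)) = ENNReal.ofReal (μ n) := by
  simp only [expect_slotLaw, expect_const]
  rw [expect_serviceLaw_eval svc n (fun k => (k : ℝ≥0∞)), expect_eq_ofReal_mean (h.svc_le n),
    h.svc_mean]

/-- Coefficients are nonnegative because expectations live in `[0, ∞]`; negative drift terms are
therefore carried on the opposite side of every inequality. -/
theorem SlotBounds.expect_linear (h : SlotBounds arr svc μ lam M) (d : PMF (Fin N))
    {x : Fin N → ℝ} {y : ℝ} (hx : ∀ n, 0 ≤ x n) (hy : 0 ≤ y) :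
    expect (slotLaw arr svc d) (fun ω => ENNReal.ofReal (∑ n, x n * ω.2.1 n + y * ω.1)) =
      ENNReal.ofReal (∑ n, x n * μ n + y * lam) := by
  have hl := h.lam_nonneg
  have hm := h.mu_nonneg
  have h1 : ∀ ω : ℕ × (Fin N → ℕ) × Fin N, ENNReal.ofReal (∑ n, x n * ω.2.1 n + y * ω.1) =
      ∑ n, ENNReal.ofReal (x n) * (ω.2.1 n : ℝ≥0∞) + ENNReal.ofReal y * (ω.1 : ℝ≥0∞) := by
    intro ω
    rw [ENNReal.ofReal_add (Finset.sum_nonneg fun n _ => mul_nonneg (hx n) (Nat.cast_nonneg _))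
      (by positivity), ENNReal.ofReal_sum_of_nonneg
      (fun n _ => mul_nonneg (hx n) (Nat.cast_nonneg _)), ENNReal.ofReal_mul hy]
    simp only [ENNReal.ofReal_mul (hx _), ENNReal.ofReal_natCast]
  simp only [h1, expect_add, expect_finset_sum, expect_const_mul, h.expect_arrivals,
    h.expect_service]
  rw [ENNReal.ofReal_add (Finset.sum_nonneg fun n _ => mul_nonneg (hx n) (hm n))
      (by positivity), ENNReal.ofReal_sum_of_nonneg
      (fun n _ => mul_nonneg (hx n) (hm n)), ENNReal.ofReal_mul hy]
  simp only [ENNReal.ofReal_mul (hx _)]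

/-- Integration over one slot of an inequality that is affine in arrivals and services. -/
theorem SlotBounds.expect_le (h : SlotBounds arr svc μ lam M) {d : PMF (Fin N)}
    {f : ℕ × (Fin N → ℕ) × Fin N → ℝ} {x x' : Fin N → ℝ} {y y' c e G : ℝ} (hf : ∀ ω, 0 ≤ f ω)
    (hx : ∀ n, 0 ≤ x n) (hx' : ∀ n, 0 ≤ x' n) (hy : 0 ≤ y) (hy' : 0 ≤ y') (hc : 0 ≤ c) (he : 0 ≤ e)
    (hpt : ∀ ω ∈ (slotLaw arr svc d).support,
      f ω + (∑ n, x n * ω.2.1 n + y * ω.1) ≤ ∑ n, x' n * ω.2.1 n + y' * ω.1 + c)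
    (hG : (∑ n, x' n * μ n + y' * lam) + c + e ≤ (∑ n, x n * μ n + y * lam) + G) :
    expect (slotLaw arr svc d) (fun ω => ENNReal.ofReal (f ω)) + ENNReal.ofReal e ≤
      ENNReal.ofReal G := by
  have hl := h.lam_nonneg
  have hm := h.mu_nonneg
  have hsum : ∀ (u : Fin N → ℝ) (v : ℝ), (∀ n, 0 ≤ u n) → 0 ≤ v →
      (0 ≤ ∑ n, u n * μ n + v * lam) ∧
      ∀ ω : ℕ × (Fin N → ℕ) × Fin N, 0 ≤ ∑ n, u n * (ω.2.1 n : ℝ) + v * ω.1 := by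
    intro u v hu hv
    exact ⟨add_nonneg (Finset.sum_nonneg fun n _ => mul_nonneg (hu n) (hm n)) (by positivity),
      fun ω => add_nonneg (Finset.sum_nonneg fun n _ => mul_nonneg (hu n) (by positivity))
        (by positivity)⟩
  set X := expect (slotLaw arr svc d) fun ω => ENNReal.ofReal (f ω) with hX
  have h1 : X + ENNReal.ofReal (∑ n, x n * μ n + y * lam) ≤
      ENNReal.ofReal (∑ n, x' n * μ n + y' * lam + c) := by
    rw [ENNReal.ofReal_add (hsum x' y' hx' hy').1 hc, ← h.expect_linear d hx hy,
      ← h.expect_linear d hx' hy', ← expect_const (slotLaw arr svc d) (ENNReal.ofReal c), hX,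
      ← expect_add, ← expect_add]
    refine expect_mono fun ω hω => ?_
    rw [← ENNReal.ofReal_add (hf ω) ((hsum x y hx hy).2 ω),
      ← ENNReal.ofReal_add ((hsum x' y' hx' hy').2 ω) hc]
    exact ENNReal.ofReal_le_ofReal (hpt ω hω)
  have h2 : ∑ n, x n * μ n + y * lam ≤ ∑ n, x' n * μ n + y' * lam + c :=
    (ENNReal.ofReal_le_ofReal_iff (add_nonneg (hsum x' y' hx' hy').1 hc)).1 (le_add_self.trans h1)
  have h3 : X ≤ ENNReal.ofReal (∑ n, x' n * μ n + y' * lam + c - (∑ n, x n * μ n + y * lam)) := by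
    rw [ENNReal.ofReal_sub _ (hsum x y hx hy).1]
    exact ENNReal.le_sub_of_add_le_right ENNReal.ofReal_ne_top h1
  refine (add_le_add_left h3 _).trans ?_
  rw [← ENNReal.ofReal_add (by linarith) he]
  exact ENNReal.ofReal_le_ofReal (by linarith)

end Moments

/-! ### The stationary balance equations of a queue -/

/-- Balance of the first two moments of a queue length `q` in stationarity, where `a` and `s` are
the arrivals and services of a slot and `U` is the unused service. -/
theorem stationary_balance {α Ω : Type*} {ν : α → PMF Ω} {F : α → Ω → α} {q : α → ℕ} {a s : Ω → ℕ}
    {U : α → Ω → ℕ} {A S A₂ S₂ ε : ℝ≥0∞}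
    (hA : ∀ z, expect (ν z) (fun ω => (a ω : ℝ≥0∞)) = A)
    (hS : ∀ z, expect (ν z) (fun ω => (s ω : ℝ≥0∞)) = S)
    (hA₂ : ∀ z, expect (ν z) (fun ω => (a ω : ℝ≥0∞) ^ 2) = A₂)
    (hS₂ : ∀ z, expect (ν z) (fun ω => (s ω : ℝ≥0∞) ^ 2) = S₂)
    (hAS : ∀ z, expect (ν z) (fun ω => (a ω : ℝ≥0∞) * (s ω : ℝ≥0∞)) = A * S)
    (hbal : ∀ z, ∀ ω ∈ (ν z).support, q (F z ω) + s ω = q z + a ω + U z ω)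
    (hε : S = A + ε) (hAt : A ≠ ⊤) {π : PMF α}
    (hπ : π.bind (fun z => (ν z).map (F z)) = π)
    (hfin : expect π (fun z => (q z : ℝ≥0∞) ^ 2) ≠ ⊤) :
    expect π (fun z => expect (ν z) fun ω => (U z ω : ℝ≥0∞)) = ε ∧
    expect π (fun z => expect (ν z) fun ω => (U z ω : ℝ≥0∞) ^ 2) +
        2 * ε * expect π (fun z => (q z : ℝ≥0∞)) + 2 * (A * S) =
      A₂ + S₂ + 2 * expect π (fun z => expect (ν z) fun ω => (q (F z ω) : ℝ≥0∞) * U z ω) := by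
  have hinv : ∀ f : α → ℝ≥0∞, expect π (fun z => expect (ν z) fun ω => f (F z ω)) = expect π f := by
    intro f
    conv_rhs => rw [← hπ, expect_bind]
    simp only [expect_map]
  have hq : expect π (fun z => (q z : ℝ≥0∞)) ≠ ⊤ := by
    refine ne_top_of_le_ne_top hfin (expect_mono fun z _ => ?_)
    exact_mod_cast Nat.le_self_pow two_ne_zero (q z)
  constructor
  · have h1 : expect π (fun z => expect (ν z) fun ω => (q (F z ω) : ℝ≥0∞)) + S =
        expect π (fun z => (q z : ℝ≥0∞)) + A +
          expect π (fun z => expect (ν z) fun ω => (U z ω : ℝ≥0∞)) := by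
      rw [← expect_const π S, ← expect_const π A, ← expect_add, ← expect_add, ← expect_add]
      refine expect_congr fun z _ => ?_
      rw [← hS z, ← hA z, ← expect_const (ν z) (q z : ℝ≥0∞), ← expect_add, ← expect_add,
        ← expect_add]
      exact expect_congr fun ω hω => by exact_mod_cast hbal z ω hω
    rw [hinv fun z => (q z : ℝ≥0∞), hε, ← add_assoc] at h1
    exact ((ENNReal.add_right_inj (ENNReal.add_ne_top.2 ⟨hq, hAt⟩)).1 h1).symm
  · have h2 : expect π (fun z => expect (ν z) fun ω => (q (F z ω) : ℝ≥0∞) ^ 2) +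
          expect π (fun z => expect (ν z) fun ω => (U z ω : ℝ≥0∞) ^ 2) +
          2 * S * expect π (fun z => (q z : ℝ≥0∞)) + 2 * (A * S) =
        expect π (fun z => (q z : ℝ≥0∞) ^ 2) + 2 * A * expect π (fun z => (q z : ℝ≥0∞)) + A₂ + S₂ +
          2 * expect π (fun z => expect (ν z) fun ω => (q (F z ω) : ℝ≥0∞) * U z ω) := by
      rw [← expect_const π (2 * (A * S)), ← expect_const π A₂, ← expect_const π S₂]
      simp only [← expect_const_mul π, ← expect_add]
      refine expect_congr fun z _ => ?_
      rw [← hAS z, ← hS₂ z, ← hA₂ z, mul_assoc, mul_assoc]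
      nth_rewrite 1 [← hS z]
      rw [← hA z, ← expect_const (ν z) ((q z : ℝ≥0∞) ^ 2)]
      simp only [← expect_mul_const (ν z), ← expect_const_mul (ν z), ← expect_add]
      refine expect_congr fun ω hω => ?_
      have h := hbal z ω hω
      -- The square of `q' - U = q + a - s`, with every negative term moved across so that it reads
      -- in `ℕ`.
      have hid : q (F z ω) ^ 2 + U z ω ^ 2 + 2 * (s ω * q z) + 2 * (a ω * s ω) =
          q z ^ 2 + 2 * (a ω * q z) + a ω ^ 2 + s ω ^ 2 + 2 * (q (F z ω) * U z ω) := by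
        zify at h ⊢
        linear_combination ((q (F z ω) : ℤ) - U z ω + q z + a ω - s ω) * h
      exact_mod_cast hid
    rw [hinv fun z => (q z : ℝ≥0∞) ^ 2, hε] at h2
    rw [hε]
    -- The common part of both sides must be finite to be cancelled; this is where the finite second
    -- moment is needed.
    have hc : expect π (fun z => (q z : ℝ≥0∞) ^ 2) + 2 * A * expect π (fun z => (q z : ℝ≥0∞)) ≠ ⊤ :=
      ENNReal.add_ne_top.2 ⟨hfin, ENNReal.mul_ne_top (ENNReal.mul_ne_top (by simp) hAt) hq⟩
    refine (ENNReal.add_right_inj hc).1 ?_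
    calc _ = _ := by ring
      _ = _ := h2
      _ = _ := by ring

/-! ### Euclidean size and dispersion of a queue length vector -/

section Size

variable {N : ℕ}

/-- The Euclidean norm of a queue length vector. -/
noncomputable def size (Q : Fin N → ℕ) : ℝ :=
  ‖(WithLp.toLp 2 fun n => (Q n : ℝ) : EuclideanSpace ℝ (Fin N))‖

/-- The Euclidean distance of a queue length vector from the diagonal. -/
noncomputable def dispersion (Q : Fin N → ℕ) : ℝ :=
  ‖(WithLp.toLp 2 fun n => (Q n : ℝ) - (∑ i, (Q i : ℝ)) / N : EuclideanSpace ℝ (Fin N))‖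

theorem size_nonneg (Q : Fin N → ℕ) : 0 ≤ size Q := norm_nonneg _

theorem dispersion_nonneg (Q : Fin N → ℕ) : 0 ≤ dispersion Q := norm_nonneg _

theorem size_sq (Q : Fin N → ℕ) : size Q ^ 2 = ∑ n, (Q n : ℝ) ^ 2 := by
  rw [size, EuclideanSpace.real_norm_sq_eq]

theorem dispersion_sq_eq_sum (Q : Fin N → ℕ) :
    dispersion Q ^ 2 = ∑ n, ((Q n : ℝ) - (∑ i, (Q i : ℝ)) / N) ^ 2 := by
  rw [dispersion, EuclideanSpace.real_norm_sq_eq]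

theorem sum_sub_sq [NeZero N] (x : Fin N → ℝ) (c : ℝ) :
    ∑ n, (x n - c) ^ 2 = ∑ n, x n ^ 2 - 2 * c * ∑ n, x n + N * c ^ 2 := by
  simp only [sub_sq, Finset.sum_add_distrib, Finset.sum_sub_distrib, Finset.mul_sum]
  simp only [Finset.sum_const, Finset.card_univ, Fintype.card_fin, nsmul_eq_mul]
  congr 2
  exact Finset.sum_congr rfl fun n _ => by ring

/-- Pythagoras: the component along the diagonal has squared norm `(∑ Q)² / N`. -/
theorem dispersion_sq [NeZero N] (Q : Fin N → ℕ) :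
    dispersion Q ^ 2 = size Q ^ 2 - (∑ i, (Q i : ℝ)) ^ 2 / N := by
  have hN : (N : ℝ) ≠ 0 := Nat.cast_ne_zero.2 (NeZero.ne N)
  rw [dispersion_sq_eq_sum, size_sq, sum_sub_sq]
  field_simp
  ring

theorem norm_toLp_le [NeZero N] {v : Fin N → ℝ} {b : ℝ} (h : ∀ n, |v n| ≤ b) :
    ‖(WithLp.toLp 2 v : EuclideanSpace ℝ (Fin N))‖ ≤ N * b := by
  have hb : 0 ≤ b := (abs_nonneg _).trans (h 0)
  have hN : (1 : ℝ) ≤ N := by exact_mod_cast NeZero.one_le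
  refine abs_le_of_sq_le_sq' ?_ (by positivity) |>.2
  rw [EuclideanSpace.real_norm_sq_eq]
  calc ∑ n, v n ^ 2 ≤ ∑ _n : Fin N, b ^ 2 :=
        Finset.sum_le_sum fun n _ => sq_le_sq.2 (by rw [abs_of_nonneg hb]; exact h n)
    _ = N * b ^ 2 := by simp
    _ ≤ (N * b) ^ 2 := by rw [mul_pow]; gcongr; nlinarith

theorem coord_le_size (Q : Fin N → ℕ) (n : Fin N) : (Q n : ℝ) ≤ size Q := by
  refine abs_le_of_sq_le_sq' ?_ (size_nonneg Q) |>.2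
  rw [size_sq]
  exact Finset.single_le_sum (f := fun n => (Q n : ℝ) ^ 2) (fun _ _ => sq_nonneg _)
    (Finset.mem_univ n)

theorem abs_sub_avg_le_dispersion (Q : Fin N → ℕ) (n : Fin N) :
    |(Q n : ℝ) - (∑ i, (Q i : ℝ)) / N| ≤ dispersion Q := by
  refine abs_le_of_sq_le_sq ?_ (dispersion_nonneg Q)
  rw [dispersion_sq_eq_sum]
  exact Finset.single_le_sum (f := fun n => ((Q n : ℝ) - (∑ i, (Q i : ℝ)) / N) ^ 2)
    (fun _ _ => sq_nonneg _) (Finset.mem_univ n)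

theorem total_le_size (Q : Fin N → ℕ) : ∑ n, (Q n : ℝ) ≤ N * size Q :=
  (Finset.sum_le_sum fun n _ => coord_le_size Q n).trans_eq (by simp)

theorem size_le_total (Q : Fin N → ℕ) : size Q ≤ ∑ n, (Q n : ℝ) := by
  refine abs_le_of_sq_le_sq' ?_ (Finset.sum_nonneg fun n _ => Nat.cast_nonneg _) |>.2
  rw [size_sq]
  exact Finset.sum_sq_le_sq_sum_of_nonneg fun n _ => Nat.cast_nonneg _

/-- The dispersion is at most the total excess over any lower bound of the queue lengths. -/
theorem dispersion_le_excess [NeZero N] {Q : Fin N → ℕ} {m : ℝ} (hm : ∀ n, m ≤ Q n) :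
    dispersion Q ≤ ∑ n, ((Q n : ℝ) - m) := by
  have hN : (0 : ℝ) < N := Nat.cast_pos.2 (NeZero.pos N)
  have h0 : ∀ n, 0 ≤ (Q n : ℝ) - m := fun n => sub_nonneg.2 (hm n)
  refine abs_le_of_sq_le_sq' ?_ (Finset.sum_nonneg fun n _ => h0 n) |>.2
  -- The distance to the diagonal is at most the distance to its point `(m, …, m)`; the Euclidean
  -- norm is then bounded by the `ℓ¹` norm.
  have h1 : dispersion Q ^ 2 ≤ ∑ n, ((Q n : ℝ) - m) ^ 2 := by
    rw [dispersion_sq_eq_sum, sum_sub_sq, sum_sub_sq]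
    set s := ∑ n, (Q n : ℝ)
    have : -(2 * m * s) + N * m ^ 2 - (-(2 * (s / N) * s) + N * (s / N) ^ 2) =
        N * (m - s / N) ^ 2 := by
      field_simp
      ring
    nlinarith [mul_nonneg hN.le (sq_nonneg (m - s / N))]
  exact h1.trans (Finset.sum_sq_le_sq_sum_of_nonneg fun n _ => h0 n)

theorem abs_size_sub_le [NeZero N] {Q Q' : Fin N → ℕ} {b : ℝ}
    (h : ∀ n, |(Q' n : ℝ) - Q n| ≤ b) : |size Q' - size Q| ≤ N * b := by
  refine (abs_norm_sub_norm_le _ _).trans ?_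
  rw [← WithLp.toLp_sub]
  exact norm_toLp_le h

/-- Each centred coordinate moves by at most `2 * b`: `b` from the coordinate and `b` from the
average. -/
theorem abs_dispersion_sub_le [NeZero N] {Q Q' : Fin N → ℕ} {b : ℝ}
    (h : ∀ n, |(Q' n : ℝ) - Q n| ≤ b) : |dispersion Q' - dispersion Q| ≤ N * (2 * b) := by
  have hN : (0 : ℝ) < N := Nat.cast_pos.2 (NeZero.pos N)
  refine (abs_norm_sub_norm_le _ _).trans ?_
  rw [← WithLp.toLp_sub]
  refine norm_toLp_le fun n => ?_
  have havg : |(∑ i, (Q' i : ℝ)) / N - (∑ i, (Q i : ℝ)) / N| ≤ b := by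
    rw [← sub_div, ← Finset.sum_sub_distrib, abs_div, abs_of_pos hN, div_le_iff₀ hN]
    refine (Finset.abs_sum_le_sum_abs _ _).trans ((Finset.sum_le_sum fun i _ => h i).trans_eq ?_)
    simp [mul_comm]
  have := h n
  simp only [Pi.sub_apply]
  rw [abs_le] at *
  constructor <;> linarith [this.1, this.2, havg.1, havg.2]

end Size

/-! ### One slot of the system -/

section Slot

variable {N : ℕ}

theorem nextQueue_cast_sq_le (Q : Fin N → ℕ) (a : ℕ) (s : Fin N) (S : Fin N → ℕ) (n : Fin N) :
    (nextQueue Q a s S n : ℝ) ^ 2 ≤ ((Q n : ℝ) + (if n = s then (a : ℝ) else 0) - S n) ^ 2 := by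
  have hc : ((if n = s then a else 0 : ℕ) : ℝ) = if n = s then (a : ℝ) else 0 := by
    split_ifs <;> simp
  rw [← hc, nextQueue]
  rcases le_total (S n) (Q n + if n = s then a else 0) with h | h
  · rw [Nat.cast_sub h, Nat.cast_add]
  · rw [Nat.sub_eq_zero_of_le h]
    simpa using sq_nonneg _

theorem abs_nextQueue_sub_le {M : ℕ} (Q : Fin N → ℕ) {a : ℕ} (s : Fin N) {S : Fin N → ℕ}
    (ha : a ≤ M) (hS : ∀ n, S n ≤ M) (n : Fin N) : |(nextQueue Q a s S n : ℝ) - Q n| ≤ M := by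
  have h1 := hS n
  rw [abs_le]
  have h2 : Q n ≤ nextQueue Q a s S n + M := by simp only [nextQueue]; split_ifs <;> omega
  have h3 : nextQueue Q a s S n ≤ Q n + M := by simp only [nextQueue]; split_ifs <;> omega
  have h2' : (Q n : ℝ) ≤ nextQueue Q a s S n + M := by exact_mod_cast h2
  have h3' : (nextQueue Q a s S n : ℝ) ≤ Q n + M := by exact_mod_cast h3
  constructor <;> linarith

/-- Truncation at zero only decreases squares. Arrival and service both lie in `[0, M]`, so their
squared difference costs at most `M ^ 2` per queue. -/
theorem size_nextQueue_sq_le {M : ℕ} (Q : Fin N → ℕ) {a : ℕ} (s : Fin N) {S : Fin N → ℕ}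
    (ha : a ≤ M) (hS : ∀ n, S n ≤ M) :
    size (nextQueue Q a s S) ^ 2 + ∑ n, 2 * Q n * (S n : ℝ) ≤
      size Q ^ 2 + 2 * Q s * a + N * (M : ℝ) ^ 2 := by
  rw [size_sq, size_sq]
  have h1 : ∀ n, (nextQueue Q a s S n : ℝ) ^ 2 + 2 * Q n * (S n : ℝ) ≤
      (Q n : ℝ) ^ 2 + (if n = s then 2 * (Q n : ℝ) * a else 0) + (M : ℝ) ^ 2 := by
    intro n
    have h2 := nextQueue_cast_sq_le Q a s S n
    have hSn : (S n : ℝ) ≤ M := by exact_mod_cast hS n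
    have haM : (a : ℝ) ≤ M := by exact_mod_cast ha
    have hS0 : (0 : ℝ) ≤ S n := Nat.cast_nonneg _
    have ha0 : (0 : ℝ) ≤ a := Nat.cast_nonneg _
    split_ifs at h2 ⊢ <;> nlinarith
  calc _ = ∑ n, ((nextQueue Q a s S n : ℝ) ^ 2 + 2 * Q n * (S n : ℝ)) :=
        (Finset.sum_add_distrib).symm
    _ ≤ ∑ n, ((Q n : ℝ) ^ 2 + (if n = s then 2 * (Q n : ℝ) * a else 0) + (M : ℝ) ^ 2) :=
        Finset.sum_le_sum fun n _ => h1 n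
    _ = _ := by simp [Finset.sum_add_distrib]

/-- The service of a slot that is not used by the queues. -/
def unused (Q : Fin N → ℕ) (a : ℕ) (s : Fin N) (S : Fin N → ℕ) : ℕ :=
  ∑ n, (S n - (Q n + if n = s then a else 0))

theorem total_nextQueue (Q : Fin N → ℕ) (a : ℕ) (s : Fin N) (S : Fin N → ℕ) :
    ∑ n, nextQueue Q a s S n + ∑ n, S n = ∑ n, Q n + a + unused Q a s S := by
  have h : ∑ n, Q n + a = ∑ n, (Q n + if n = s then a else 0) := by
    simp [Finset.sum_add_distrib]
  rw [h, unused, ← Finset.sum_add_distrib, ← Finset.sum_add_distrib]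
  refine Finset.sum_congr rfl fun n _ => ?_
  simp only [nextQueue]
  omega

theorem unused_le {M : ℕ} (Q : Fin N → ℕ) (a : ℕ) (s : Fin N) {S : Fin N → ℕ}
    (hS : ∀ n, S n ≤ M) : unused Q a s S ≤ N * M := by
  refine (Finset.sum_le_sum (g := fun _ => M) fun n _ => ?_).trans_eq (by simp)
  exact (Nat.sub_le _ _).trans (hS n)

/-- If some service is unused, one of the queues is empty, so that the total queue length is
controlled by the dispersion. -/
theorem total_le_dispersion_of_unused (Q : Fin N → ℕ) (a : ℕ) (s : Fin N)
    (S : Fin N → ℕ) (h : unused Q a s S ≠ 0) :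
    ∑ n, (nextQueue Q a s S n : ℝ) ≤ 2 * N * dispersion (nextQueue Q a s S) := by
  obtain ⟨i, -, hi⟩ := Finset.exists_ne_zero_of_sum_ne_zero h
  have h0 : nextQueue Q a s S i = 0 := by
    simp only [nextQueue]
    omega
  set Q' := nextQueue Q a s S
  have h1 := abs_sub_avg_le_dispersion Q' i
  rw [h0] at h1
  -- The empty queue `i` bounds the average by the dispersion, and every queue exceeds the average
  -- by at most the dispersion.
  have h2 : ∀ n, (Q' n : ℝ) ≤ 2 * dispersion Q' := fun n => by
    have h3 := abs_sub_avg_le_dispersion Q' n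
    rw [abs_le] at h1 h3
    push_cast at h1
    linarith [h1.1, h3.2]
  refine (Finset.sum_le_sum fun n _ => h2 n).trans_eq ?_
  simp
  ring

theorem dispersion_nextQueue_sq_le [NeZero N] {M : ℕ} (Q : Fin N → ℕ) {a : ℕ} (s : Fin N)
    {S : Fin N → ℕ} (ha : a ≤ M) (hS : ∀ n, S n ≤ M) :
    dispersion (nextQueue Q a s S) ^ 2 +
        (∑ n, 2 * Q n * (S n : ℝ) + 2 * ((∑ n, (Q n : ℝ)) / N) * a) ≤
      ∑ n, 2 * ((∑ n, (Q n : ℝ)) / N) * (S n : ℝ) + 2 * Q s * a +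
        (dispersion Q ^ 2 + N * (M : ℝ) ^ 2) := by
  have hN : (0 : ℝ) < N := Nat.cast_pos.2 (NeZero.pos N)
  have h1 := size_nextQueue_sq_le Q s ha hS
  have h2 : (∑ n, (Q n : ℝ)) + a ≤ ∑ n, (nextQueue Q a s S n : ℝ) + ∑ n, (S n : ℝ) := by
    exact_mod_cast (total_nextQueue Q a s S).symm ▸ Nat.le_add_right _ _
  rw [dispersion_sq, dispersion_sq, ← Finset.mul_sum]
  set q := ∑ n, (Q n : ℝ) with hq
  set q' := ∑ n, (nextQueue Q a s S n : ℝ)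
  set σ := ∑ n, (S n : ℝ)
  have hq0 : 0 ≤ q := Finset.sum_nonneg fun n _ => Nat.cast_nonneg _
  -- The tangent to the square at `q` gives `q'² ≥ q² + 2 q (q' - q)`, so that `q + a - σ` may have
  -- either sign.
  have h3 : q ^ 2 + 2 * q * (a - σ) ≤ q' ^ 2 := by
    nlinarith [sq_nonneg (q' - q), mul_le_mul_of_nonneg_left h2 hq0]
  have h4 : (q ^ 2 + 2 * q * (a - σ)) / N ≤ q' ^ 2 / N := by gcongr
  have h5 : (q ^ 2 + 2 * q * (a - σ)) / N = q ^ 2 / N + 2 * (q / N) * a - 2 * (q / N) * σ := by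
    ring
  linarith

end Slot

/-! ### Drift under join-shortest-queue -/

section Drift

variable {N : ℕ} {arr : PMF ℕ} {svc : Fin N → PMF ℕ} {μ : Fin N → ℝ} {lam : ℝ} {M : ℕ}

/-- The successor of a state under JSQ, given the randomness of the slot. -/
def jsqNext (z : State N) (ω : ℕ × (Fin N → ℕ) × Fin N) : State N :=
  (nextQueue z.1 ω.1 ω.2.2 ω.2.1, ∅)

theorem transition_jsq [NeZero N] (t : ℕ) (z : State N) :
    transition (jsq N) arr svc t z =
      (slotLaw arr svc (PMF.uniformOfFinset (shortest z.1) (shortest_nonempty z.1))).map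
        (jsqNext z) := by
  simp only [transition, slotLaw, PMF.map_bind, PMF.map_comp, jsq, PMF.pure_map]
  rfl

theorem mem_support_transition_jsq [NeZero N] (h : SlotBounds arr svc μ lam M) {t : ℕ}
    {z z' : State N} (hz : z' ∈ (transition (jsq N) arr svc t z).support) (n : Fin N) :
    |(z'.1 n : ℝ) - z.1 n| ≤ M := by
  rw [transition_jsq, PMF.mem_support_map_iff] at hz
  obtain ⟨ω, hω, rfl⟩ := hz
  obtain ⟨h1, h2, -⟩ := mem_support_slotLaw hω
  exact abs_nextQueue_sub_le z.1 _ (h.arr_le _ h1) (fun n => h.svc_le n _ (h2 n)) n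

theorem mem_slotLaw_jsq [NeZero N] (h : SlotBounds arr svc μ lam M) {z : State N}
    {ω : ℕ × (Fin N → ℕ) × Fin N} (hω : ω ∈ (slotLaw arr svc
      (PMF.uniformOfFinset (shortest z.1) (shortest_nonempty z.1))).support) :
    ω.1 ≤ M ∧ (∀ n, ω.2.1 n ≤ M) ∧ ∀ n, z.1 ω.2.2 ≤ z.1 n := by
  obtain ⟨h1, h2, h3⟩ := mem_support_slotLaw hω
  refine ⟨h.arr_le _ h1, fun n => h.svc_le n _ (h2 n), ?_⟩
  rw [PMF.support_uniformOfFinset] at h3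
  simpa [shortest] using h3

/-- With `D = ∑ Q_n μ_n` and `m = ∑ μ_n`, the minimal length is at most `D / m`. The linear drift is
thus at most `-2 (m - lam) D / m`, and `D ≥ μ₀ * size`. -/
theorem size_drift [NeZero N] (h : SlotBounds arr svc μ lam M) {μ₀ : ℝ} (hμ₀ : 0 < μ₀)
    (hμ : ∀ n, μ₀ ≤ μ n) (hlam : lam < ∑ n, μ n) (t : ℕ) (z : State N) :
    expect (transition (jsq N) arr svc t z) (fun z' => ENNReal.ofReal (size z'.1 ^ 2)) +
        ENNReal.ofReal (2 * (μ₀ * (∑ n, μ n - lam) / ∑ n, μ n) * size z.1) ≤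
      ENNReal.ofReal (size z.1 ^ 2 + N * (M : ℝ) ^ 2) := by
  obtain ⟨i, hi⟩ := shortest_nonempty z.1
  have hi' : ∀ n, z.1 i ≤ z.1 n := by simpa [shortest] using hi
  have hpos : 0 < ∑ n, μ n := h.lam_nonneg.trans_lt hlam
  have hη : 0 ≤ μ₀ * (∑ n, μ n - lam) / ∑ n, μ n :=
    div_nonneg (mul_nonneg hμ₀.le (by linarith)) hpos.le
  rw [transition_jsq, expect_map]
  refine h.expect_le (x := fun n => 2 * z.1 n) (x' := 0) (y := 0) (y' := 2 * z.1 i)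
    (c := size z.1 ^ 2 + N * (M : ℝ) ^ 2) (fun ω => sq_nonneg _) (fun n => by positivity)
    (fun n => le_rfl) le_rfl (by positivity) (by positivity)
    (mul_nonneg (mul_nonneg two_pos.le hη) (size_nonneg _)) (fun ω hω => ?_) ?_
  · obtain ⟨h1, h2, h3⟩ := mem_slotLaw_jsq h hω
    have h4 := size_nextQueue_sq_le z.1 ω.2.2 h1 h2
    have h5 : z.1 ω.2.2 = z.1 i := le_antisymm (h3 i) (hi' _)
    rw [h5] at h4
    simp only [Pi.zero_apply, zero_mul, Finset.sum_const_zero, zero_add, add_zero]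
    simp only [jsqNext]
    linarith
  · simp only [Pi.zero_apply, zero_mul, Finset.sum_const_zero, zero_add, add_zero]
    have h6 : (z.1 i : ℝ) * ∑ n, μ n ≤ ∑ n, z.1 n * μ n := by
      rw [Finset.mul_sum]
      exact Finset.sum_le_sum fun n _ =>
        mul_le_mul_of_nonneg_right (by exact_mod_cast hi' n) (h.mu_nonneg n)
    have h7 : μ₀ * size z.1 ≤ ∑ n, z.1 n * μ n := by
      refine (mul_le_mul_of_nonneg_left (size_le_total z.1) hμ₀.le).trans ?_
      rw [Finset.mul_sum]
      exact Finset.sum_le_sum fun n _ => by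
        rw [mul_comm]
        exact mul_le_mul_of_nonneg_left (hμ n) (Nat.cast_nonneg _)
    have h8 : ∑ n, 2 * (z.1 n : ℝ) * μ n = 2 * ∑ n, z.1 n * μ n := by
      rw [Finset.mul_sum]
      exact Finset.sum_congr rfl fun n _ => by ring
    rw [h8]
    set D := ∑ n, (z.1 n : ℝ) * μ n
    set m := ∑ n, μ n
    have h9 : μ₀ * (m - lam) / m * size z.1 ≤ (m - lam) / m * D := by
      rw [mul_comm μ₀, mul_div_right_comm, mul_assoc]
      exact mul_le_mul_of_nonneg_left h7 (div_nonneg (by linarith) hpos.le)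
    have h10 : (m - lam) / m * D = D - lam * (D / m) := by field_simp
    have h11 : lam * (z.1 i : ℝ) ≤ lam * (D / m) :=
      mul_le_mul_of_nonneg_left ((le_div_iff₀ hpos).2 h6) h.lam_nonneg
    linarith

/-- Let `e` be the total excess over the shortest queue `i`. Half of the linear drift is `-∑ (Q_n -
Q_i) μ_n + (∑ μ - lam) e / N`, at most `-μ₀ e + (μ₀ / 2) e`, and `e` dominates the dispersion. The
rate `μ₀ / 2` does not involve `lam`. -/
theorem dispersion_drift [NeZero N] (h : SlotBounds arr svc μ lam M) {μ₀ : ℝ} (hμ₀ : 0 < μ₀)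
    (hμ : ∀ n, μ₀ ≤ μ n) (hlam : ∑ n, μ n - lam ≤ μ₀ / 2) (t : ℕ) (z : State N) :
    expect (transition (jsq N) arr svc t z) (fun z' => ENNReal.ofReal (dispersion z'.1 ^ 2)) +
        ENNReal.ofReal (2 * (μ₀ / 2) * dispersion z.1) ≤
      ENNReal.ofReal (dispersion z.1 ^ 2 + N * (M : ℝ) ^ 2) := by
  obtain ⟨i, hi⟩ := shortest_nonempty z.1
  have hi' : ∀ n, z.1 i ≤ z.1 n := by simpa [shortest] using hi
  have hir : ∀ n, (z.1 i : ℝ) ≤ z.1 n := fun n => by exact_mod_cast hi' n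
  have hN : (1 : ℝ) ≤ N := by exact_mod_cast NeZero.one_le
  have hq0 : 0 ≤ ∑ n, (z.1 n : ℝ) := Finset.sum_nonneg fun n _ => Nat.cast_nonneg _
  rw [transition_jsq, expect_map]
  refine h.expect_le (x := fun n => 2 * z.1 n) (x' := fun _ => 2 * ((∑ n, (z.1 n : ℝ)) / N))
    (y := 2 * ((∑ n, (z.1 n : ℝ)) / N)) (y' := 2 * z.1 i)
    (c := dispersion z.1 ^ 2 + N * (M : ℝ) ^ 2) (fun ω => sq_nonneg _) (fun n => by positivity)
    (fun n => by positivity) (by positivity) (by positivity) (by positivity)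
    (mul_nonneg (by positivity) (dispersion_nonneg _)) (fun ω hω => ?_) ?_
  · obtain ⟨h1, h2, h3⟩ := mem_slotLaw_jsq h hω
    have h4 := dispersion_nextQueue_sq_le z.1 ω.2.2 h1 h2
    have h5 : z.1 ω.2.2 = z.1 i := le_antisymm (h3 i) (hi' _)
    rw [h5] at h4
    exact h4
  · have hex := dispersion_le_excess hir
    have hex2 : ∑ n, ((z.1 n : ℝ) - z.1 i) = ∑ n, (z.1 n : ℝ) - N * z.1 i := by simp
    have h7 : μ₀ * ∑ n, ((z.1 n : ℝ) - z.1 i) ≤ ∑ n, z.1 n * μ n - z.1 i * ∑ n, μ n := by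
      rw [Finset.mul_sum, Finset.mul_sum, ← Finset.sum_sub_distrib]
      refine Finset.sum_le_sum fun n _ => ?_
      nlinarith [mul_le_mul_of_nonneg_right (hμ n) (sub_nonneg.2 (hir n))]
    have h8 : ∑ n, 2 * (z.1 n : ℝ) * μ n = 2 * ∑ n, z.1 n * μ n := by
      rw [Finset.mul_sum]
      exact Finset.sum_congr rfl fun n _ => by ring
    rw [h8, ← Finset.mul_sum]
    set D := ∑ n, (z.1 n : ℝ) * μ n
    set m := ∑ n, μ n
    set q := ∑ n, (z.1 n : ℝ)
    have hE0 : 0 ≤ q - N * z.1 i := hex2 ▸ (dispersion_nonneg _).trans hex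
    rw [hex2] at h7 hex
    have h9 : (m - lam) * (q / N - z.1 i) ≤ μ₀ / 2 * (q - N * z.1 i) := by
      have h10 : q / N - z.1 i = (q - N * z.1 i) / N := by field_simp
      have h11 : (q - N * z.1 i) / N ≤ q - N * z.1 i := div_le_self hE0 hN
      have h12 : 0 ≤ (q - N * z.1 i) / N := div_nonneg hE0 (by linarith)
      rw [h10]
      exact (mul_le_mul_of_nonneg_right hlam h12).trans (mul_le_mul_of_nonneg_left h11 (by positivity))
    nlinarith

end Drift

/-! ### JSQ and tilted distributions -/

section Tilt

variable {N : ℕ} [NeZero N] {μ : Fin N → ℝ}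

theorem minRate_le (μ : Fin N → ℝ) (n : Fin N) : minRate μ ≤ μ n :=
  Finset.inf'_le _ (Finset.mem_univ n)

theorem minRate_pos (hμ : ∀ n, 0 < μ n) : 0 < minRate μ := by
  rw [minRate, Finset.lt_inf'_iff]
  exact fun n _ => hμ n

theorem sum_rates_pos (hμ : ∀ n, 0 < μ n) : 0 < ∑ n, μ n :=
  Finset.sum_pos (fun n _ => hμ n) Finset.univ_nonempty

/-- The distribution that always selects the first server of the ordering is tilted. -/
theorem isDeltaTilted_of_first (hN : 2 ≤ N) (hμ : ∀ n, 0 < μ n) (τ : Equiv.Perm (Fin N))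
    {P : Fin N → ℝ} (h0 : P 0 = 1) (h1 : ∀ n, n ≠ 0 → P n = 0) :
    IsDeltaTilted μ (minRate μ / ∑ n, μ n) τ P := by
  have hpos := sum_rates_pos hμ
  have hmin := minRate_pos hμ
  have hfirst : ∀ n : Fin N, (n : ℕ) = 0 → minRate μ / ∑ n, μ n ≤ tilt μ τ P n := by
    intro n hn
    obtain rfl : n = 0 := Fin.ext hn
    -- `1 - μ (τ 0) / μ_Σ` is the share of the other servers, at least that of a single one of them.
    obtain ⟨j, hj⟩ : ∃ j : Fin N, j ≠ τ 0 :=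
      have : Nontrivial (Fin N) := Fin.nontrivial_iff_two_le.2 hN
      exists_ne _
    have h2 : μ (τ 0) + μ j ≤ ∑ n, μ n := by
      rw [← Finset.sum_pair hj.symm]
      exact Finset.sum_le_sum_of_subset_of_nonneg (Finset.subset_univ _) fun n _ _ => (hμ n).le
    rw [tilt, h0, le_sub_iff_add_le, ← add_div, div_le_one hpos]
    linarith [minRate_le μ j]
  have hlast : ∀ n : Fin N, n ≠ 0 → tilt μ τ P n ≤ -(minRate μ / ∑ n, μ n) := by
    intro n hn
    rw [tilt, h1 n hn, zero_sub, neg_le_neg_iff]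
    gcongr
    exact minRate_le μ _
  refine ⟨by positivity, ⟨2, le_rfl, hN, fun n hn => ?_, fun n hn => ?_⟩, hfirst, fun n hn => ?_⟩
  · exact le_trans (by positivity) (hfirst n (by omega))
  · refine (hlast n ?_).trans (by rw [neg_nonpos]; positivity)
    rintro rfl
    simp at hn
  · refine hlast n ?_
    rintro rfl
    simp at hn
    omega

theorem apply_zero_le_of_sorts {Q : Fin N → ℕ} {τ : Equiv.Perm (Fin N)} (h : Sorts Q τ) (n : Fin N) :
    Q (τ 0) ≤ Q n := by
  have := h (Fin.zero_le (τ.symm n))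
  simpa using this

theorem jsq_deltaTiltedUpToEquiv (hN : 2 ≤ N) (hμ : ∀ n, 0 < μ n) (t : ℕ) (z : State N) :
    DeltaTiltedUpToEquiv μ (minRate μ / ∑ n, μ n) (jsq N) t z := by
  intro τ hτ
  refine ⟨Pi.single 0 1, single_mem_stdSimplex ℝ 0, ?_,
    isDeltaTilted_of_first hN hμ τ (by simp) fun n hn => by simp [hn]⟩
  have h1 : ∀ n, (z.1 (τ n) : ℝ) * sortedDispatch (jsq N) t z τ n =
      z.1 (τ 0) * sortedDispatch (jsq N) t z τ n := by
    intro n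
    by_cases hn : τ n ∈ shortest z.1
    · have h2 : ∀ i, z.1 (τ n) ≤ z.1 i := by simpa [shortest] using hn
      rw [le_antisymm (h2 (τ 0)) (apply_zero_le_of_sorts hτ _)]
    · simp [sortedDispatch, jsq, PMF.uniformOfFinset_apply_of_notMem _ hn]
  have h2 : ∑ n, sortedDispatch (jsq N) t z τ n = 1 := by
    simp only [sortedDispatch]
    rw [Equiv.sum_comp τ fun n => (((jsq N).dispatch t z) n).toReal,
      ← ENNReal.toReal_sum fun n _ => PMF.apply_ne_top _ _, ← tsum_fintype (L := .unconditional _), PMF.tsum_coe,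
      ENNReal.toReal_one]
  rw [InnerEquiv, Finset.sum_congr rfl fun n _ => h1 n, ← Finset.mul_sum, h2]
  simp [Pi.single_apply]

theorem jsq_isDeltaTilted_of_injective (hN : 2 ≤ N) (hμ : ∀ n, 0 < μ n) (t : ℕ) (z : State N)
    (τ : Equiv.Perm (Fin N)) (hz : Function.Injective z.1) (hτ : Sorts z.1 τ) :
    IsDeltaTilted μ (minRate μ / ∑ n, μ n) τ (sortedDispatch (jsq N) t z τ) := by
  have hs : shortest z.1 = {τ 0} := by
    ext n
    simp only [shortest, Finset.mem_filter, Finset.mem_univ, true_and, Finset.mem_singleton]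
    constructor
    · exact fun h => hz (le_antisymm (h _) (apply_zero_le_of_sorts hτ n))
    · rintro rfl
      exact apply_zero_le_of_sorts hτ
  refine isDeltaTilted_of_first hN hμ τ ?_ fun n hn => ?_
  · simp [sortedDispatch, jsq, hs]
  · simp [sortedDispatch, jsq, hs, hn]

theorem jsq_classPi (hN : 2 ≤ N) (hμ : ∀ n, 0 < μ n) : ClassPi μ (jsq N) := by
  refine ⟨fun t z τ hτ => ?_, 1, minRate μ / ∑ n, μ n, one_pos,
    div_pos (minRate_pos hμ) (sum_rates_pos hμ), fun k => ⟨k, by simp, fun z =>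
      jsq_deltaTiltedUpToEquiv hN hμ k z⟩⟩
  obtain ⟨P, hP, h1, h2⟩ := jsq_deltaTiltedUpToEquiv hN hμ t z τ hτ
  exact ⟨P, hP, h1, h2.2.1⟩

end Tilt

/-! ### Stability -/

section Auxiliary

/-- Dominated convergence for the counting measure, with the summable majorant `p`. -/
theorem expect_tendsto_zero {α ι : Type*} {l : Filter ι} [l.IsCountablyGenerated] (p : PMF α)
    {g : ι → α → ℝ≥0∞} (hg : ∀ i z, g i z ≤ 1) (hlim : ∀ z, Tendsto (fun i => g i z) l (𝓝 0)) :
    Tendsto (fun i => expect p (g i)) l (𝓝 0) := by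
  let _ : MeasurableSpace α := ⊤
  have h := tendsto_lintegral_filter_of_dominated_convergence (μ := Measure.count) (l := l)
    (F := fun i z => p z * g i z) (f := fun _ => 0) (fun z => p z)
    (Eventually.of_forall fun i => measurable_from_top)
    (Eventually.of_forall fun i => ae_of_all _ fun z => mul_le_of_le_one_right' (hg i z))
    (by rw [lintegral_count, PMF.tsum_coe]; exact ENNReal.one_ne_top)
    (ae_of_all _ fun z => by
      simpa using ENNReal.Tendsto.const_mul (hlim z) (Or.inr (PMF.apply_ne_top p z)))
  simp only [lintegral_count, tsum_zero] at h
  exact h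

theorem le_of_exp_mul_le {θ x b : ℝ} (hθ : 0 < θ) (h : Real.exp (θ * x) ≤ b) : x ≤ b / θ := by
  rw [le_div_iff₀' hθ]
  linarith [Real.add_one_le_exp (θ * x)]

variable {N : ℕ} {arr : PMF ℕ} {svc : Fin N → PMF ℕ} {μ : Fin N → ℝ} {lam : ℝ} {M : ℕ}

theorem slotBounds_of_isServiceLaw {Smax : ℕ} {Amax : ℕ} (hS : ∀ n, BoundedBy Smax (svc n))
    (hm : ∀ n, mean (svc n) = μ n) (hA : BoundedBy Amax arr) :
    SlotBounds arr svc μ (mean arr) (max Amax Smax) :=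
  ⟨fun k hk => (hA k hk).trans (le_max_left _ _), fun n k hk => (hS n k hk).trans (le_max_right _ _),
    rfl, hm⟩

theorem finite_setOf_total_le (b : ℝ) : {z : State N | ∑ n, (z.1 n : ℝ) ≤ b}.Finite := by
  refine ((Set.finite_Iic (fun _ : Fin N => ⌊b⌋₊)).prod (Set.finite_univ)).subset fun z hz => ?_
  refine ⟨fun n => Nat.le_floor (le_trans ?_ hz), Set.mem_univ _⟩
  exact Finset.single_le_sum (f := fun n => (z.1 n : ℝ)) (fun _ _ => Nat.cast_nonneg _)
    (Finset.mem_univ n)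

theorem mem_slotLaw (h : SlotBounds arr svc μ lam M) {d : PMF (Fin N)}
    {ω : ℕ × (Fin N → ℕ) × Fin N} (hω : ω ∈ (slotLaw arr svc d).support) :
    ω.1 ≤ M ∧ ∑ n, ω.2.1 n ≤ N * M := by
  obtain ⟨h1, h2, -⟩ := mem_support_slotLaw hω
  exact ⟨h.arr_le _ h1, (Finset.sum_le_sum fun n _ => h.svc_le n _ (h2 n)).trans_eq (by simp)⟩

end Auxiliary

section Stability

variable {N : ℕ} [NeZero N] {arr : PMF ℕ} {svc : Fin N → PMF ℕ} {μ : Fin N → ℝ} {lam : ℝ} {M : ℕ}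

theorem transition_jsq_eq (t : ℕ) :
    transition (jsq N) arr svc t = transition (jsq N) arr svc 0 :=
  funext fun z => by rw [transition_jsq, transition_jsq]

theorem law_jsq (init : PMF (State N)) (t : ℕ) :
    law (jsq N) arr svc init t = iterLaw (transition (jsq N) arr svc 0) init t := by
  induction t with
  | zero => rfl
  | succ t ih => rw [law, iterLaw, ih, transition_jsq_eq t]

theorem exists_size_exp_drift (h : SlotBounds arr svc μ lam M) (hμ : ∀ n, 0 < μ n)
    (hlam : lam < ∑ n, μ n) :
    ∃ θ c C : ℝ, 0 < θ ∧ 0 < c ∧ c < 1 ∧ 0 ≤ C ∧ ∀ z : State N,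
      expect (transition (jsq N) arr svc 0 z)
          (fun z => ENNReal.ofReal (Real.exp (θ * size z.1))) ≤
        ENNReal.ofReal ((1 - c) * Real.exp (θ * size z.1) + C) := by
  have hη : 0 < minRate μ * (∑ n, μ n - lam) / ∑ n, μ n :=
    div_pos (mul_pos (minRate_pos hμ) (sub_pos.2 hlam)) (sum_rates_pos hμ)
  -- The `+ 1` in `B` keeps it positive even when `M = 0`.
  obtain ⟨θ, c, C, hθ, hc, hc1, hC, hdrift⟩ := exists_exp_drift (α := State N) hη
    (K₀ := N * (M : ℝ) ^ 2) (B := N * M + 1) (by positivity) (by positivity)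
  refine ⟨θ, c, C, hθ, hc, hc1, hC, fun z => hdrift _ (fun z => size z.1) (size z.1)
    (fun z => size_nonneg _) (size_nonneg _) (fun z' hz' => ?_)
    (size_drift h (minRate_pos hμ) (minRate_le μ) hlam 0 z)⟩
  exact (abs_size_sub_le (mem_support_transition_jsq h hz')).trans (by linarith)

theorem jsq_isStable (h : SlotBounds arr svc μ lam M) (hμ : ∀ n, 0 < μ n)
    (hlam : lam < ∑ n, μ n) (init : PMF (State N)) : IsStable (jsq N) arr svc init := by
  obtain ⟨θ, c, C, hθ, hc, hc1, hC, hdrift⟩ := exists_size_exp_drift h hμ hlam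
  have hN : (0 : ℝ) < N := Nat.cast_pos.2 (NeZero.pos N)
  -- Chernoff bound for a chain started at `z`, uniform in time. The cap at `1` allows dominated
  -- convergence under an initial law without exponential moments.
  set g : ℝ → State N → ℝ≥0∞ := fun b z => min 1
    (ENNReal.ofReal (Real.exp (-(θ / N * b))) * ENNReal.ofReal (Real.exp (θ * size z.1) + C / c))
    with hg
  have hbound : ∀ (b : ℝ) (t : ℕ), (law (jsq N) arr svc init t).toOuterMeasure
      {z | b < ((∑ n, z.1 n : ℕ) : ℝ)} ≤ expect init (g b) := by
    intro b t
    rw [toOuterMeasure_eq_expect, law_jsq, iterLaw_eq_bind, expect_bind]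
    refine expect_mono fun z _ => le_min ?_ ?_
    · exact expect_le_of_le fun z _ => Set.indicator_le_self' (fun _ _ => zero_le) z
    · refine le_trans ?_ (mul_le_mul_right (expect_iterLaw_pure_le hc hc1 hC
        (fun z => (Real.exp_pos _).le) hdrift z t) _)
      rw [← expect_const_mul]
      refine expect_mono fun z' _ => ?_
      by_cases hz' : z' ∈ {z : State N | b < ((∑ n, z.1 n : ℕ) : ℝ)}
      swap
      · rw [Set.indicator_of_notMem hz']
        exact zero_le
      rw [Set.indicator_of_mem hz']
      rw [← ENNReal.ofReal_mul (Real.exp_pos _).le, ← Real.exp_add, Pi.one_apply,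
        ← ENNReal.ofReal_one]
      refine ENNReal.ofReal_le_ofReal (Real.one_le_exp ?_)
      have h1 : b < ∑ n, (z'.1 n : ℝ) := by exact_mod_cast hz'
      have h2 : b ≤ N * size z'.1 := h1.le.trans (total_le_size z'.1)
      have h3 : θ / N * b ≤ θ / N * (N * size z'.1) := by gcongr
      have h4 : θ / N * (N * size z'.1) = θ * size z'.1 := by field_simp
      linarith
  have hlim : Tendsto (fun b => expect init (g b)) atTop (𝓝 0) := by
    refine expect_tendsto_zero init (fun b z => min_le_left _ _) fun z => ?_
    have h1 : Tendsto (fun b : ℝ => Real.exp (-(θ / N * b))) atTop (𝓝 0) :=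
      Real.tendsto_exp_neg_atTop_nhds_zero.comp (tendsto_id.const_mul_atTop (by positivity))
    have h2 := ENNReal.Tendsto.mul_const (b := ENNReal.ofReal (Real.exp (θ * size z.1) + C / c))
      (ENNReal.tendsto_ofReal h1) (Or.inr ENNReal.ofReal_ne_top)
    rw [ENNReal.ofReal_zero, zero_mul] at h2
    exact tendsto_of_tendsto_of_tendsto_of_le_of_le tendsto_const_nhds h2 (fun _ => zero_le)
      fun b => min_le_right _ _
  refine le_antisymm ?_ zero_le
  rw [← hlim.limsup_eq]
  exact limsup_le_limsup (Eventually.of_forall fun b => limsup_le_of_le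
    (h := Eventually.of_forall fun t => hbound b t))

theorem jsq_throughputOptimal (hμ : ∀ n, 0 < μ n) : ThroughputOptimal μ (jsq N) := by
  rintro svc ⟨⟨Smax, hS⟩, hm⟩ arr Amax hA hlam init
  exact jsq_isStable (slotBounds_of_isServiceLaw hS hm hA) hμ hlam init

theorem exists_isStationary_jsq (h : SlotBounds arr svc μ lam M) (hμ : ∀ n, 0 < μ n)
    (hlam : lam < ∑ n, μ n) : ∃ π, IsStationary (jsq N) arr svc π := by
  obtain ⟨θ, c, C, hθ, hc, hc1, hC, hdrift⟩ := exists_size_exp_drift h hμ hlam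
  have hfin : ∀ b : ℝ, {z : State N | Real.exp (θ * size z.1) ≤ b}.Finite := fun b =>
    (finite_setOf_total_le (N * (b / θ))).subset fun z hz => (total_le_size z.1).trans
      (mul_le_mul_of_nonneg_left (le_of_exp_mul_le hθ hz) (by positivity))
  obtain ⟨π, hπ⟩ := exists_stationary hc hc1 hC (fun z => (Real.exp_pos _).le) hfin hdrift
  exact ⟨π, fun t => by rw [transition_jsq_eq, hπ]⟩

end Stability

/-! ### The resource-pooled queue -/

section Pooled

variable {N : ℕ} [NeZero N] {arr : PMF ℕ} {svc : Fin N → PMF ℕ} {μ : Fin N → ℝ} {lam : ℝ} {M : ℕ}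

/-- The successor of a queue length in the resource-pooled system, given the randomness of the
slot. -/
def pooledNext (q : ℕ) (ω : ℕ × (Fin N → ℕ) × Fin N) : ℕ := q + ω.1 - ∑ n, ω.2.1 n

/-- The dispatching coordinate is a dummy: with it, the slot moments computed for the parallel
system also serve the pooled queue. -/
theorem pooledTransition_eq (q : ℕ) :
    pooledTransition arr svc q = (slotLaw arr svc (PMF.pure 0)).map (pooledNext q) := by
  simp only [pooledTransition, slotLaw, PMF.map_bind, PMF.pure_map]
  rfl

theorem exists_pooled_exp_drift (h : SlotBounds arr svc μ lam M) (hlam : lam < ∑ n, μ n) :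
    ∃ θ c C : ℝ, 0 < θ ∧ 0 < c ∧ c < 1 ∧ 0 ≤ C ∧ ∀ q : ℕ,
      expect (pooledTransition arr svc q) (fun q => ENNReal.ofReal (Real.exp (θ * q))) ≤
        ENNReal.ofReal ((1 - c) * Real.exp (θ * q) + C) := by
  obtain ⟨θ, c, C, hθ, hc, hc1, hC, hdrift⟩ := exists_exp_drift (α := ℕ) (sub_pos.2 hlam)
    (K₀ := (M + N * M : ℝ) ^ 2) (B := M + N * M + 1) (by positivity) (by positivity)
  refine ⟨θ, c, C, hθ, hc, hc1, hC, fun q => hdrift _ (fun q => (q : ℝ)) q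
    (fun q => Nat.cast_nonneg _) (Nat.cast_nonneg _) (fun q' hq' => ?_) ?_⟩
  · rw [pooledTransition_eq, PMF.mem_support_map_iff] at hq'
    obtain ⟨ω, hω, rfl⟩ := hq'
    obtain ⟨h1, h2⟩ := mem_slotLaw h hω
    have h3 : pooledNext q ω ≤ q + M := by simp only [pooledNext]; omega
    have h4 : q ≤ pooledNext q ω + N * M := by simp only [pooledNext]; omega
    have h3' : (pooledNext q ω : ℝ) ≤ q + M := by exact_mod_cast h3
    have h4' : (q : ℝ) ≤ pooledNext q ω + N * M := by exact_mod_cast h4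
    have hM : (0 : ℝ) ≤ M := Nat.cast_nonneg _
    have hNM : (0 : ℝ) ≤ N * M := by positivity
    rw [abs_le]
    constructor <;> linarith
  · rw [pooledTransition_eq, expect_map]
    have hη : 0 ≤ ∑ n, μ n - lam := (sub_pos.2 hlam).le
    refine h.expect_le (x := fun _ => 2 * q) (x' := 0) (y := 0) (y' := 2 * q)
      (c := (q : ℝ) ^ 2 + (M + N * M : ℝ) ^ 2) (fun ω => sq_nonneg _) (fun n => by positivity)
      (fun n => le_rfl) le_rfl (by positivity) (by positivity) (by positivity) (fun ω hω => ?_) ?_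
    · obtain ⟨h1, h2⟩ := mem_slotLaw h hω
      simp only [Pi.zero_apply, zero_mul, Finset.sum_const_zero, zero_add, add_zero,
        ← Finset.mul_sum, ← Nat.cast_sum]
      have h1' : (ω.1 : ℝ) ≤ M := by exact_mod_cast h1
      have h2' : ((∑ n, ω.2.1 n : ℕ) : ℝ) ≤ N * M := by exact_mod_cast h2
      have h3 : (pooledNext q ω : ℝ) ^ 2 ≤ ((q : ℝ) + ω.1 - (∑ n, ω.2.1 n : ℕ)) ^ 2 := by
        rw [pooledNext]
        rcases le_total (∑ n, ω.2.1 n) (q + ω.1) with hle | hle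
        · rw [Nat.cast_sub hle, Nat.cast_add]
        · rw [Nat.sub_eq_zero_of_le hle]
          simpa using sq_nonneg _
      have h4 : (0 : ℝ) ≤ ω.1 := Nat.cast_nonneg _
      have h5 : (0 : ℝ) ≤ (∑ n, ω.2.1 n : ℕ) := Nat.cast_nonneg _
      have h6 : ((ω.1 : ℝ) - (∑ n, ω.2.1 n : ℕ)) ^ 2 ≤ (M + N * M : ℝ) ^ 2 := by
        refine sq_le_sq' ?_ ?_ <;> linarith
      linarith
    · simp only [Pi.zero_apply, zero_mul, Finset.sum_const_zero, zero_add, add_zero,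
        ← Finset.mul_sum]
      linarith

theorem exists_isPooledStationary (h : SlotBounds arr svc μ lam M) (hlam : lam < ∑ n, μ n) :
    ∃ ρ, IsPooledStationary arr svc ρ := by
  obtain ⟨θ, c, C, hθ, hc, hc1, hC, hdrift⟩ := exists_pooled_exp_drift h hlam
  have hfin : ∀ b : ℝ, {q : ℕ | Real.exp (θ * q) ≤ b}.Finite := fun b =>
    (Set.finite_Iic ⌊b / θ⌋₊).subset fun q hq => Nat.le_floor (le_of_exp_mul_le hθ hq)
  exact exists_stationary hc hc1 hC (fun z => (Real.exp_pos _).le) hfin hdrift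

end Pooled

/-! ### Heavy traffic -/

section HeavyTraffic

/-- For `y ≥ 0` one has `y² / 2 ≤ exp y`, applied to `y = θ * R z`. -/
theorem expect_sq_le_of_exp {α : Type*} {π : PMF α} {R : α → ℝ} (hR : ∀ z, 0 ≤ R z) {θ D : ℝ}
    (hθ : 0 < θ) (h : expect π (fun z => ENNReal.ofReal (Real.exp (θ * R z))) ≤ ENNReal.ofReal D) :
    expect π (fun z => ENNReal.ofReal (R z ^ 2)) ≤ ENNReal.ofReal (2 / θ ^ 2 * D) := by
  rw [ENNReal.ofReal_mul (by positivity)]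
  refine le_trans ?_ (mul_le_mul_right h _)
  rw [← expect_const_mul]
  refine expect_mono fun z _ => ?_
  rw [← ENNReal.ofReal_mul (by positivity)]
  refine ENNReal.ofReal_le_ofReal ?_
  have h1 := Real.quadratic_le_exp_of_nonneg (mul_nonneg hθ.le (hR z))
  have h2 : 0 ≤ θ * R z := mul_nonneg hθ.le (hR z)
  rw [div_mul_eq_mul_div, le_div_iff₀ (by positivity)]
  nlinarith

variable {N : ℕ} {arr : PMF ℕ} {svc : Fin N → PMF ℕ} {μ : Fin N → ℝ} {lam : ℝ} {M : ℕ}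

/-- The second moment of the total service offered in a slot. -/
noncomputable def serviceSecondMoment (svc : Fin N → PMF ℕ) : ℝ :=
  (expect (serviceLaw svc) fun S => ((∑ n, S n : ℕ) : ℝ≥0∞) ^ 2).toReal

theorem SlotBounds.expect_total_service (h : SlotBounds arr svc μ lam M) (d : PMF (Fin N)) :
    expect (slotLaw arr svc d) (fun ω => ((∑ n, ω.2.1 n : ℕ) : ℝ≥0∞)) =
      ENNReal.ofReal (∑ n, μ n) := by
  simp only [Nat.cast_sum, expect_finset_sum, h.expect_service]
  rw [ENNReal.ofReal_sum_of_nonneg fun n _ => h.mu_nonneg n]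

theorem SlotBounds.expect_arrivals_sq (h : SlotBounds arr svc μ lam M) (d : PMF (Fin N)) :
    expect (slotLaw arr svc d) (fun ω => (ω.1 : ℝ≥0∞) ^ 2) =
      ENNReal.ofReal (var arr + lam ^ 2) := by
  simp only [expect_slotLaw, expect_const]
  rw [expect_sq_eq_ofReal h.arr_le, h.arr_mean]

theorem SlotBounds.expect_total_service_sq (h : SlotBounds arr svc μ lam M) (d : PMF (Fin N)) :
    expect (slotLaw arr svc d) (fun ω => ((∑ n, ω.2.1 n : ℕ) : ℝ≥0∞) ^ 2) =
      ENNReal.ofReal (serviceSecondMoment svc) := by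
  simp only [expect_slotLaw, expect_const]
  rw [serviceSecondMoment, ENNReal.ofReal_toReal]
  refine ne_top_of_le_ne_top (b := ((N * M : ℕ) : ℝ≥0∞) ^ 2)
    (ENNReal.pow_ne_top (ENNReal.natCast_ne_top _)) (expect_le_of_le fun S hS => ?_)
  gcongr
  exact (Finset.sum_le_sum fun n _ => h.svc_le n _ (mem_support_of_mem_serviceLaw hS n)).trans_eq
    (by simp)

theorem SlotBounds.expect_arrivals_mul_service (h : SlotBounds arr svc μ lam M)
    (d : PMF (Fin N)) :
    expect (slotLaw arr svc d) (fun ω => (ω.1 : ℝ≥0∞) * ((∑ n, ω.2.1 n : ℕ) : ℝ≥0∞)) =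
      ENNReal.ofReal lam * ENNReal.ofReal (∑ n, μ n) := by
  rw [← h.expect_total_service d, ← h.expect_arrivals d]
  simp only [expect_slotLaw, expect_const, expect_const_mul, expect_mul_const]

/-- The balance equations of a stationary queue that receives the arrivals and the total service of a
slot, in real numbers. The number `X` is the mean product of queue length and unused service. -/
theorem SlotBounds.balance {α : Type*} (h : SlotBounds arr svc μ lam M)
    {d : α → PMF (Fin N)} {F : α → ℕ × (Fin N → ℕ) × Fin N → α} {q : α → ℕ}
    {U : α → ℕ × (Fin N → ℕ) × Fin N → ℕ}
    (hbal : ∀ z, ∀ ω ∈ (slotLaw arr svc (d z)).support,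
      q (F z ω) + ∑ n, ω.2.1 n = q z + ω.1 + U z ω)
    (hU : ∀ z, ∀ ω ∈ (slotLaw arr svc (d z)).support, U z ω ≤ N * M)
    (hlam : lam ≤ ∑ n, μ n) {π : PMF α}
    (hπ : π.bind (fun z => (slotLaw arr svc (d z)).map (F z)) = π)
    (hfin : expect π (fun z => (q z : ℝ≥0∞) ^ 2) ≠ ⊤) :
    expect π (fun z => expect (slotLaw arr svc (d z)) fun ω => (U z ω : ℝ≥0∞)) =
      ENNReal.ofReal (∑ n, μ n - lam) ∧
    expect π (fun z => (q z : ℝ≥0∞)) ≠ ⊤ ∧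
    ∃ X Y : ℝ, 0 ≤ X ∧ 0 ≤ Y ∧ Y ≤ N * M * (∑ n, μ n - lam) ∧
      ENNReal.ofReal X = expect π (fun z => expect (slotLaw arr svc (d z)) fun ω =>
        (q (F z ω) : ℝ≥0∞) * U z ω) ∧
      Y + 2 * (∑ n, μ n - lam) * (expect π fun z => (q z : ℝ≥0∞)).toReal +
        2 * (lam * ∑ n, μ n) = var arr + lam ^ 2 + serviceSecondMoment svc + 2 * X := by
  have hl := h.lam_nonneg
  have hε : 0 ≤ ∑ n, μ n - lam := sub_nonneg.2 hlam
  obtain ⟨hb1, hb2⟩ := stationary_balance (fun z => h.expect_arrivals (d z))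
    (fun z => h.expect_total_service (d z)) (fun z => h.expect_arrivals_sq (d z))
    (fun z => h.expect_total_service_sq (d z)) (fun z => h.expect_arrivals_mul_service (d z)) hbal
    (ε := ENNReal.ofReal (∑ n, μ n - lam)) (by rw [← ENNReal.ofReal_add hl hε]; congr 1; ring)
    ENNReal.ofReal_ne_top hπ hfin
  have hq : expect π (fun z => (q z : ℝ≥0∞)) ≠ ⊤ := by
    refine ne_top_of_le_ne_top hfin (expect_mono fun z _ => ?_)
    exact_mod_cast Nat.le_self_pow two_ne_zero (q z)
  refine ⟨hb1, hq, ?_⟩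
  set JU := expect π fun z => expect (slotLaw arr svc (d z)) fun ω => (U z ω : ℝ≥0∞) ^ 2
  set JX := expect π fun z => expect (slotLaw arr svc (d z)) fun ω => (q (F z ω) : ℝ≥0∞) * U z ω
  have hJU : JU ≤ ENNReal.ofReal (N * M * (∑ n, μ n - lam)) := by
    rw [ENNReal.ofReal_mul (by positivity), ← hb1, ← expect_const_mul]
    refine expect_mono fun z _ => ?_
    rw [← expect_const_mul]
    refine expect_mono fun ω hω => ?_
    rw [← Nat.cast_mul, ENNReal.ofReal_natCast, sq]
    gcongr
    exact hU z ω hω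
  have hJU' : JU ≠ ⊤ := ne_top_of_le_ne_top ENNReal.ofReal_ne_top hJU
  have hR : JU + 2 * ENNReal.ofReal (∑ n, μ n - lam) * expect π (fun z => (q z : ℝ≥0∞)) ≠ ⊤ :=
    ENNReal.add_ne_top.2 ⟨hJU', ENNReal.mul_ne_top (ENNReal.mul_ne_top (by simp)
      ENNReal.ofReal_ne_top) hq⟩
  have hR2 : 2 * (ENNReal.ofReal lam * ENNReal.ofReal (∑ n, μ n)) ≠ ⊤ :=
    ENNReal.mul_ne_top (by simp) (ENNReal.mul_ne_top ENNReal.ofReal_ne_top ENNReal.ofReal_ne_top)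
  -- The other side of the balance equation is already known to be finite.
  have hJX : JX ≠ ⊤ := by
    intro htop
    rw [htop, ENNReal.mul_top (by simp), add_top] at hb2
    exact ENNReal.add_ne_top.2 ⟨hR, hR2⟩ hb2
  refine ⟨JX.toReal, JU.toReal, ENNReal.toReal_nonneg, ENNReal.toReal_nonneg,
    ENNReal.toReal_le_of_le_ofReal (by positivity) hJU, ENNReal.ofReal_toReal hJX, ?_⟩
  have hvar : 0 ≤ var arr + lam ^ 2 := add_nonneg (variance_nonneg _ _) (sq_nonneg _)
  have h2 := congrArg ENNReal.toReal hb2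
  rw [ENNReal.toReal_add hR hR2, ENNReal.toReal_add hJU' (ENNReal.add_ne_top.1 hR).2,
    ENNReal.toReal_add (ENNReal.add_ne_top.2 ⟨ENNReal.ofReal_ne_top, ENNReal.ofReal_ne_top⟩)
      (ENNReal.mul_ne_top (by simp) hJX),
    ENNReal.toReal_add ENNReal.ofReal_ne_top ENNReal.ofReal_ne_top] at h2
  simp only [ENNReal.toReal_mul, ENNReal.toReal_ofNat, ENNReal.toReal_ofReal hε,
    ENNReal.toReal_ofReal hl, ENNReal.toReal_ofReal (hl.trans hlam), ENNReal.toReal_ofReal hvar] at h2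
  rwa [ENNReal.toReal_ofReal (by exact ENNReal.toReal_nonneg)] at h2

/-- Scaled queue lengths that satisfy the balance equations with vanishing errors converge. -/
theorem tendsto_scaled {T : ℝ → ℝ≥0∞} {w : ℝ → ℝ} {m v s K : ℝ}
    (hw : Tendsto w (𝓝[>] 0) (𝓝 v))
    (h : ∀ᶠ ε in 𝓝[>] (0 : ℝ), T ε ≠ ⊤ ∧ ∃ X Y : ℝ, 0 ≤ X ∧ X ≤ K * √ε ∧ 0 ≤ Y ∧ Y ≤ K * ε ∧
      Y + 2 * ε * (T ε).toReal + 2 * ((m - ε) * m) = w ε + (m - ε) ^ 2 + s + 2 * X) :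
    Tendsto (fun ε => ENNReal.ofReal ε * T ε) (𝓝[>] 0)
      (𝓝 (ENNReal.ofReal ((v - m ^ 2 + s) / 2))) := by
  have hid : Tendsto (fun ε : ℝ => ε) (𝓝[>] 0) (𝓝 0) := tendsto_id.mono_left nhdsWithin_le_nhds
  have hsqrt : Tendsto (fun ε : ℝ => √ε) (𝓝[>] 0) (𝓝 0) := by
    simpa using (Real.continuous_sqrt.tendsto 0).mono_left nhdsWithin_le_nhds
  -- `(m - ε)² - 2 (m - ε) m = ε² - m²` gives the main term; `X` and `Y` are the errors.
  have hmain : Tendsto (fun ε => (w ε + ε ^ 2 - m ^ 2 + s) / 2) (𝓝[>] 0)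
      (𝓝 ((v - m ^ 2 + s) / 2)) := by
    simpa using (((hw.add (hid.pow 2)).sub_const (m ^ 2)).add_const s).div_const 2
  have hlow : Tendsto (fun ε => (w ε + ε ^ 2 - m ^ 2 + s) / 2 - K * ε) (𝓝[>] 0)
      (𝓝 ((v - m ^ 2 + s) / 2)) := by
    simpa using hmain.sub (hid.const_mul K)
  have hupp : Tendsto (fun ε => (w ε + ε ^ 2 - m ^ 2 + s) / 2 + K * √ε) (𝓝[>] 0)
      (𝓝 ((v - m ^ 2 + s) / 2)) := by
    simpa using hmain.add (hsqrt.const_mul K)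
  have hreal : Tendsto (fun ε => ε * (T ε).toReal) (𝓝[>] 0) (𝓝 ((v - m ^ 2 + s) / 2)) := by
    refine tendsto_of_tendsto_of_tendsto_of_le_of_le' hlow hupp ?_ ?_
    · filter_upwards [h] with ε ⟨_, X, Y, hX, hXK, hY, hYK, he⟩
      nlinarith
    · filter_upwards [h] with ε ⟨_, X, Y, hX, hXK, hY, hYK, he⟩
      nlinarith
  refine (ENNReal.tendsto_ofReal hreal).congr' ?_
  filter_upwards [h, self_mem_nhdsWithin] with ε hε hpos
  rw [ENNReal.ofReal_mul (Set.mem_Ioi.1 hpos).le, ENNReal.ofReal_toReal hε.1]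

/-- The bound `d ≤ x + d² / x`, for the dispersion `d`, replaces Cauchy–Schwarz; the free parameter
`x` is later tuned to `ε`. -/
theorem total_mul_unused_le (Q : Fin N → ℕ) (a : ℕ) (s : Fin N) {S : Fin N → ℕ}
    (hS : ∀ n, S n ≤ M) {x : ℝ} (hx : 0 < x) :
    ((∑ n, nextQueue Q a s S n : ℕ) : ℝ≥0∞) * (unused Q a s S : ℝ≥0∞) ≤
      ENNReal.ofReal (2 * N * x) * (unused Q a s S : ℝ≥0∞) +
        ENNReal.ofReal (2 * N * (N * M / x)) *
          ENNReal.ofReal (dispersion (nextQueue Q a s S) ^ 2) := by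
  have hle : (unused Q a s S : ℝ) ≤ N * M := by exact_mod_cast unused_le Q a s hS
  by_cases h0 : unused Q a s S = 0
  · simp [h0]
  have h1 := total_le_dispersion_of_unused Q a s S h0
  have hd := dispersion_nonneg (nextQueue Q a s S)
  have hu : (0 : ℝ) ≤ unused Q a s S := Nat.cast_nonneg _
  clear h0
  generalize unused Q a s S = u at hle hu ⊢
  generalize nextQueue Q a s S = Q' at h1 hd ⊢
  have hN : (0 : ℝ) ≤ N := Nat.cast_nonneg _
  rw [← ENNReal.ofReal_natCast, ← ENNReal.ofReal_natCast u, ← ENNReal.ofReal_mul (by positivity),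
    ← ENNReal.ofReal_mul (by positivity), ← ENNReal.ofReal_mul (by positivity),
    ← ENNReal.ofReal_add (by positivity) (by positivity)]
  refine ENNReal.ofReal_le_ofReal ?_
  rw [Nat.cast_sum]
  have h2 : dispersion Q' ≤ x + dispersion Q' ^ 2 / x := by
    rw [← sub_le_iff_le_add', le_div_iff₀ hx]
    nlinarith [sq_nonneg (dispersion Q' - x)]
  have h3 : dispersion Q' ^ 2 / x * u ≤ dispersion Q' ^ 2 / x * (N * M) := by gcongr
  calc (∑ n, (Q' n : ℝ)) * u ≤ 2 * N * dispersion Q' * u := by gcongr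
    _ ≤ 2 * N * (x + dispersion Q' ^ 2 / x) * u := by gcongr
    _ = 2 * N * (x * u + dispersion Q' ^ 2 / x * u) := by ring
    _ ≤ 2 * N * (x * u + dispersion Q' ^ 2 / x * (N * M)) := by gcongr
    _ = _ := by ring

variable [NeZero N]

/-- A single queue that leaves service unused is empty afterwards, so the cross term vanishes. -/
theorem pooled_balance (h : SlotBounds arr svc μ lam M) (hlam : lam < ∑ n, μ n) {ρ : PMF ℕ}
    (hρ : IsPooledStationary arr svc ρ) :
    expectedLength ρ ≠ ⊤ ∧ ∃ Y : ℝ, 0 ≤ Y ∧ Y ≤ N * M * (∑ n, μ n - lam) ∧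
      Y + 2 * (∑ n, μ n - lam) * (expectedLength ρ).toReal + 2 * (lam * ∑ n, μ n) =
        var arr + lam ^ 2 + serviceSecondMoment svc := by
  obtain ⟨θ, c, C, hθ, hc, hc1, hC, hdrift⟩ := exists_pooled_exp_drift h hlam
  have hsq := expect_sq_le_of_exp (fun q : ℕ => Nat.cast_nonneg q) hθ
    (expect_le_of_geometric_drift hc hc1 hC (fun z => (Real.exp_pos _).le) hdrift hρ)
  have hfin : expect ρ (fun q => (q : ℝ≥0∞) ^ 2) ≠ ⊤ := by
    refine ne_top_of_le_ne_top ENNReal.ofReal_ne_top (le_trans (le_of_eq ?_) hsq)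
    exact expect_congr fun q _ => by
      rw [ENNReal.ofReal_pow (Nat.cast_nonneg _), ENNReal.ofReal_natCast]
  obtain ⟨-, hq, X, Y, hXn, hY0, hY, hX, heq⟩ := h.balance (d := fun _ => PMF.pure 0)
    (F := pooledNext) (q := fun q => q) (U := fun q ω => ∑ n, ω.2.1 n - (q + ω.1))
    (fun q ω _ => by simp only [pooledNext]; omega)
    (fun q ω hω => (Nat.sub_le _ _).trans (mem_slotLaw h hω).2) hlam.le
    (by simpa only [IsPooledStationary, funext pooledTransition_eq] using hρ) hfin
  have hX0 : ENNReal.ofReal X = 0 := by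
    rw [hX]
    refine le_antisymm (expect_le_of_le fun q _ => expect_le_of_le fun ω _ => ?_) zero_le
    have : pooledNext q ω * (∑ n, ω.2.1 n - (q + ω.1)) = 0 := by
      rw [mul_eq_zero, pooledNext]
      omega
    exact_mod_cast this.le
  refine ⟨hq, Y, hY0, hY, ?_⟩
  have hX1 : X = 0 := le_antisymm (ENNReal.ofReal_eq_zero.1 hX0) hXn
  rw [hX1, mul_zero, add_zero] at heq
  exact heq

/-- The balance equations for JSQ. The error term `X` is controlled by the second moment of the
dispersion. -/
theorem jsq_balance (h : SlotBounds arr svc μ lam M) (hμ : ∀ n, 0 < μ n) (hlam : lam < ∑ n, μ n)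
    {π : PMF (State N)} (hπ : IsStationary (jsq N) arr svc π) {D x : ℝ} (hx : 0 < x)
    (hD0 : 0 ≤ D) (hD : expect π (fun z => ENNReal.ofReal (dispersion z.1 ^ 2)) ≤ ENNReal.ofReal D) :
    expectedTotal π ≠ ⊤ ∧ ∃ X Y : ℝ, 0 ≤ X ∧
      X ≤ 2 * N * (x * (∑ n, μ n - lam) + N * M / x * D) ∧
      0 ≤ Y ∧ Y ≤ N * M * (∑ n, μ n - lam) ∧
      Y + 2 * (∑ n, μ n - lam) * (expectedTotal π).toReal + 2 * (lam * ∑ n, μ n) =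
        var arr + lam ^ 2 + serviceSecondMoment svc + 2 * X := by
  have hε : 0 ≤ ∑ n, μ n - lam := (sub_pos.2 hlam).le
  obtain ⟨θ, c, C, hθ, hc, hc1, hC, hdrift⟩ := exists_size_exp_drift h hμ hlam
  have hsq := expect_sq_le_of_exp (fun z : State N => size_nonneg z.1) hθ
    (expect_le_of_geometric_drift hc hc1 hC (fun z => (Real.exp_pos _).le) hdrift (hπ 0))
  have hfin : expect π (fun z => ((∑ n, z.1 n : ℕ) : ℝ≥0∞) ^ 2) ≠ ⊤ := by
    refine ne_top_of_le_ne_top (b := ENNReal.ofReal ((N : ℝ) ^ 2) * _)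
      (ENNReal.mul_ne_top ENNReal.ofReal_ne_top ENNReal.ofReal_ne_top)
      (le_trans ?_ (mul_le_mul_right hsq _))
    rw [← expect_const_mul]
    refine expect_mono fun z _ => ?_
    rw [← ENNReal.ofReal_mul (by positivity), ← mul_pow, ← ENNReal.ofReal_natCast,
      ← ENNReal.ofReal_pow (Nat.cast_nonneg _)]
    refine ENNReal.ofReal_le_ofReal ?_
    gcongr
    rw [Nat.cast_sum]
    exact total_le_size z.1
  have hπ' : π.bind (fun z => (slotLaw arr svc
      (PMF.uniformOfFinset (shortest z.1) (shortest_nonempty z.1))).map (jsqNext z)) = π := by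
    rw [← funext fun z => transition_jsq (arr := arr) (svc := svc) 0 z]
    exact hπ 0
  have hbal : ∀ z : State N, ∀ ω ∈ (slotLaw arr svc
      (PMF.uniformOfFinset (shortest z.1) (shortest_nonempty z.1))).support,
      ∑ n, (jsqNext z ω).1 n + ∑ n, ω.2.1 n = ∑ n, z.1 n + ω.1 + unused z.1 ω.1 ω.2.2 ω.2.1 :=
    fun z ω _ => total_nextQueue z.1 ω.1 ω.2.2 ω.2.1
  have hunused : ∀ z : State N, ∀ ω ∈ (slotLaw arr svc
      (PMF.uniformOfFinset (shortest z.1) (shortest_nonempty z.1))).support,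
      unused z.1 ω.1 ω.2.2 ω.2.1 ≤ N * M :=
    fun z ω hω => unused_le z.1 ω.1 ω.2.2 (mem_slotLaw_jsq h hω).2.1
  obtain ⟨hU, hq, X, Y, hX0, hY0, hY, hX, heq⟩ := h.balance
    (d := fun z : State N => PMF.uniformOfFinset (shortest z.1) (shortest_nonempty z.1))
    (F := jsqNext) (q := fun z => ∑ n, z.1 n)
    (U := fun z ω => unused z.1 ω.1 ω.2.2 ω.2.1) hbal hunused hlam.le hπ' hfin
  refine ⟨hq, X, Y, hX0, ?_, hY0, hY, heq⟩
  rw [← ENNReal.ofReal_le_ofReal_iff (by positivity), hX]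
  -- The cross term involves the state after the slot; by stationarity its dispersion has the same
  -- second moment.
  have hinv : expect π (fun z => expect (slotLaw arr svc
      (PMF.uniformOfFinset (shortest z.1) (shortest_nonempty z.1))) fun ω =>
        ENNReal.ofReal (dispersion (jsqNext z ω).1 ^ 2)) =
      expect π (fun z => ENNReal.ofReal (dispersion z.1 ^ 2)) := by
    conv_rhs => rw [← hπ', expect_bind]
    simp only [expect_map]
  calc _ ≤ ENNReal.ofReal (2 * N * x) * ENNReal.ofReal (∑ n, μ n - lam) +
        ENNReal.ofReal (2 * N * (N * M / x)) *
          expect π (fun z => ENNReal.ofReal (dispersion z.1 ^ 2)) := by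
        rw [← hU, ← hinv]
        simp only [← expect_const_mul, ← expect_add]
        exact expect_mono fun z _ => expect_mono fun ω hω =>
          total_mul_unused_le z.1 ω.1 ω.2.2 (mem_slotLaw_jsq h hω).2.1 hx
    _ ≤ ENNReal.ofReal (2 * N * x) * ENNReal.ofReal (∑ n, μ n - lam) +
        ENNReal.ofReal (2 * N * (N * M / x)) * ENNReal.ofReal D := by gcongr
    _ = _ := by
        rw [← ENNReal.ofReal_mul (by positivity), ← ENNReal.ofReal_mul (by positivity),
          ← ENNReal.ofReal_add (by positivity) (by positivity)]
        congr 1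
        ring

/-- State space collapse: close to the capacity, the second moment of the dispersion is bounded
uniformly over all stationary laws and all arrival laws. -/
theorem exists_dispersion_bound (hμ : ∀ n, 0 < μ n) (M : ℕ) :
    ∃ D : ℝ, 0 ≤ D ∧ ∀ (arr : PMF ℕ) (svc : Fin N → PMF ℕ) (lam : ℝ) (π : PMF (State N)),
      SlotBounds arr svc μ lam M → ∑ n, μ n - lam ≤ minRate μ / 2 →
      IsStationary (jsq N) arr svc π →
      expect π (fun z => ENNReal.ofReal (dispersion z.1 ^ 2)) ≤ ENNReal.ofReal D := by
  -- The constants are fixed before the arrival and service laws: they depend only on `minRate μ`,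
  -- `N` and `M`.
  obtain ⟨θ, c, C, hθ, hc, hc1, hC, hdrift⟩ := exists_exp_drift (α := State N)
    (half_pos (minRate_pos hμ)) (K₀ := N * (M : ℝ) ^ 2) (B := N * (2 * M) + 1) (by positivity)
    (by positivity)
  refine ⟨2 / θ ^ 2 * (C / c), by positivity, fun arr svc lam π h hlam hπ => ?_⟩
  refine expect_sq_le_of_exp (fun z => dispersion_nonneg _) hθ
    (expect_le_of_geometric_drift hc hc1 hC (fun z => (Real.exp_pos _).le) (fun z => ?_) (hπ 0))
  refine hdrift _ (fun z => dispersion z.1) (dispersion z.1)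
    (fun z => dispersion_nonneg _) (dispersion_nonneg _) (fun z' hz' => ?_)
    (dispersion_drift h (minRate_pos hμ) (minRate_le μ) hlam 0 z)
  exact (abs_dispersion_sub_le (mem_support_transition_jsq h hz')).trans (by linarith)

theorem jsq_heavyTrafficDelayOptimal (hμ : ∀ n, 0 < μ n) :
    HeavyTrafficDelayOptimal μ (jsq N) := by
  rintro svc ⟨⟨Smax, hS⟩, hm⟩ ε₀ arr Amax v hε₀ harr hv
  set M := max Amax Smax
  have hslot : ∀ ε ∈ Set.Ioo 0 ε₀, SlotBounds (arr ε) svc μ (∑ n, μ n - ε) M := fun ε hε => by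
    have h := slotBounds_of_isServiceLaw hS hm (harr ε hε).1
    rwa [(harr ε hε).2] at h
  refine ⟨fun ε hε => ⟨exists_isStationary_jsq (hslot ε hε) hμ (by linarith [hε.1]),
    exists_isPooledStationary (hslot ε hε) (by linarith [hε.1])⟩,
    (((v - (∑ n, μ n) ^ 2 + serviceSecondMoment svc) / 2)).toNNReal, fun π ρ hst => ?_⟩
  obtain ⟨D, hD0, hD⟩ := exists_dispersion_bound (N := N) hμ M
  constructor
  · refine tendsto_scaled (K := N * M + 2 * N * (1 + N * M * D)) hv ?_
    filter_upwards [Ioo_mem_nhdsGT (lt_min hε₀ (half_pos (minRate_pos hμ)))] with ε hε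
    have hε' : ε ∈ Set.Ioo 0 ε₀ := ⟨hε.1, hε.2.trans_le (min_le_left _ _)⟩
    have hpos := hε.1
    have hsub : ∑ n, μ n - (∑ n, μ n - ε) = ε := sub_sub_cancel _ _
    have hsqrt : 0 < √ε := Real.sqrt_pos.2 hpos
    -- With `x = 1 / √ε` both parts of the error, `x * ε` and `N * M * D / x`, are of order `√ε`.
    obtain ⟨hT, X, Y, hX0, hX, hY0, hY, heq⟩ := jsq_balance (hslot ε hε') hμ (by linarith)
      (hst ε hε').1 (x := (√ε)⁻¹) (by positivity) hD0
      (hD _ _ _ _ (hslot ε hε') (by rw [hsub]; exact (hε.2.trans_le (min_le_right _ _)).le)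
        (hst ε hε').1)
    rw [hsub] at hX hY heq
    refine ⟨hT, X, Y, hX0, hX.trans ?_, hY0, hY.trans ?_, heq⟩
    · have h1 : (√ε)⁻¹ * ε = √ε := by
        rw [inv_mul_eq_div, Real.div_sqrt]
      rw [h1, div_inv_eq_mul]
      have : 0 ≤ (N : ℝ) * M * √ε := by positivity
      linarith
    · have : 0 ≤ 2 * (N : ℝ) * (1 + N * M * D) * ε := by positivity
      linarith
  · refine tendsto_scaled (K := N * M) hv ?_
    filter_upwards [Ioo_mem_nhdsGT hε₀] with ε hε
    have hsub : ∑ n, μ n - (∑ n, μ n - ε) = ε := sub_sub_cancel _ _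
    obtain ⟨hT, Y, hY0, hY, heq⟩ := pooled_balance (hslot ε hε) (by linarith [hε.1]) (hst ε hε).2
    rw [hsub] at hY heq
    exact ⟨hT, 0, Y, le_rfl, by positivity, hY0, hY, by simpa using heq⟩

end HeavyTraffic

end LoadBalancing

theorem mainTheorem6 (N : ℕ) [NeZero N] (hN : 2 ≤ N) (μ : Fin N → ℝ) (hμ : ∀ n, 0 < μ n) :
    LoadBalancing.ClassPi μ (LoadBalancing.jsq N) ∧
    (∀ (t : ℕ) (z : LoadBalancing.State N),
      LoadBalancing.DeltaTiltedUpToEquiv μ (LoadBalancing.minRate μ / ∑ n, μ n)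
        (LoadBalancing.jsq N) t z) ∧
    (∀ (t : ℕ) (z : LoadBalancing.State N) (τ : Equiv.Perm (Fin N)),
      Function.Injective z.1 → LoadBalancing.Sorts z.1 τ →
      LoadBalancing.IsDeltaTilted μ (LoadBalancing.minRate μ / ∑ n, μ n) τ
        (LoadBalancing.sortedDispatch (LoadBalancing.jsq N) t z τ)) ∧
    LoadBalancing.ThroughputOptimal μ (LoadBalancing.jsq N) ∧
    LoadBalancing.HeavyTrafficDelayOptimal μ (LoadBalancing.jsq N) :=
  ⟨LoadBalancing.jsq_classPi hN hμ, LoadBalancing.jsq_deltaTiltedUpToEquiv hN hμ,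
    LoadBalancing.jsq_isDeltaTilted_of_injective hN hμ,
    LoadBalancing.jsq_throughputOptimal hμ, LoadBalancing.jsq_heavyTrafficDelayOptimal hμ⟩
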